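/- **Setting.** Let $\mathcal B_1=\{\theta\in\mathbb R^d:\|\theta\|_1\le 1\}$ and let $(\mathcal F_t)_{t\ge 0}$ be a filtration on a probability space, with $\mathbb E_{t-1}=\mathbb E[\,\cdot\mid\mathcal F_{t-1}]$. Let $\ell_t:\mathbb R^d\to\mathbb R$, $t\ge1$, be random convex functions, with $\ell_t(\theta)$ integrable for $\theta\in\mathcal B_1$, and let $\nabla\ell_t(\theta)$ be a (jointly measurable) choice of a subgradient of $\ell_t$ at each $\theta\in\mathcal B_1$; $\ell_t$ and $\nabla \ell_t$ are $\mathcal F_t$-measurable. Assume: - (A1) for some $G>0$, for all $t\ge 1$, almost surely $\|\nabla\ell_t(\theta)\|_\infty\le G$ for all $\theta\in\mathcal B_1$; - (A2) for some $\alpha>0$ and $\beta\in[0,1]$, for all $t\ge1$ and all $\theta_1,\theta_2\in\mathcal B_1$, almost surely $$\mathbb E_{t-1}[\ell_t(\theta_1)-\ell_t(\theta_2)]\le\mathbb E_{t-1}[\nabla\ell_t(\theta_1)^\top(\theta_1-\theta_2)]-\mathbb E_{t-1}\Big[\big(\alpha(\nabla\ell_t(\theta_1)^\top(\theta_1-\theta_2))^2\big)^{1/\beta}\Big],$$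 where for $\beta=0$ one reads $u^{1/\beta}=0$ for $0\le u\le1$ and $u^{1/\beta}=+\infty$ for $u>1$. **Algorithm (Squint/BOA).** Let $\theta_1,\dots,\theta_K\in\mathcal B_1$, $\Delta_K=\{\pi\in[0,\infty)^K:\sum_k\pi_k=1\}$, $\hat\pi_0\in\Delta_K$, $E=4G/3$, let $T\ge1$ be an integer with $\log(ET)\ge1$, and let $\eta_i=(e^iE)^{-1}$ for integers $1\le i\le\log(ET)$. For $t=1,\dots,T$ predict $\hat\theta_{t-1}=\sum_k\hat\pi_{k,t-1}\theta_k$ and, with $r_{k,s}=\nabla\ell_s(\hat\theta_{s-1})^\top(\hat\theta_{s-1}-\theta_k)$, update $$\hat\pi_{k,t}=\frac{\sum_i\eta_i\exp\big(\eta_i\sum_{s=1}^t(r_{k,s}-\eta_ir_{k,s}^2)\big)\hat\pi_{k,0}}{\sum_{i}\sum_j\hat\pi_{j,0}\,\eta_{i}\exp\big(\eta_{i}\sum_{s=1}^t(r_{j,s}-\eta_{i}r_{j,s}^2)\big)}.$$ Let $R_T(\theta)=\frac1T\sum_{t=1}^T\mathbb E_{t-1}[\ell_t(\hat\theta_{t-1})]-\frac1T\sum_{t=1}^T\mathbb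 E_{t-1}[\ell_t(\theta)]$ be the average risk and $\mathrm{KL}(\pi,\hat\pi_0)=\sum_k\pi_k\log(\pi_k/\hat\pi_{k,0})$. **Theorem.** There is a universal constant $C>0$ such that, in every such setting and for every $x>0$, with probability at least $1-2e^{-x}$, simultaneously for all $\pi\in\Delta_K$ with $\mathrm{KL}(\pi,\hat\pi_0)<\infty$, writing $a=\mathrm{KL}(\pi,\hat\pi_0)+\log\log(GT)+x$, $$\mathbb E_{k\sim\pi}[R_T(\theta_k)]\le C\left(\Big(\frac{a}{\alpha T}\Big)^{\frac1{2-\beta}}+\frac{Ga+1}{T}\right),$$ and, if moreover $G\ge1$ and $\alpha G^{2-\beta}\le1$, then on the same event $$\mathbb E_{k\sim\pi}[R_T(\theta_k)]\le C\Big(\frac{a}{\alpha T}\Big)^{\frac1{2-\beta}}.$$ -/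

import Mathlib

open MeasureTheory ProbabilityTheory

noncomputable section

namespace OnlineBOA

/-- The unit `ℓ¹`-ball of `ℝ^d`. Vectors of `ℝ^d` are functions `Fin d → ℝ`, whose norm in Mathlib
is the sup norm; the `ℓ¹`-norm is therefore written out. -/
def l1Ball (d : ℕ) : Set (Fin d → ℝ) :=
  {θ | ∑ i, |θ i| ≤ 1}

/-- `g` is a subgradient of `f : ℝ^d → ℝ` at `θ`. -/
def IsSubgradientAt {d : ℕ} (f : (Fin d → ℝ) → ℝ) (g θ : Fin d → ℝ) : Prop :=
  ∀ θ' : Fin d → ℝ, f θ + g ⬝ᵥ (θ' - θ) ≤ f θ'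

/-- Random convex losses `ℓ t ω : ℝ^d → ℝ`, `t ≥ 1`, together with a (jointly measurable) choice
`grad t ω θ` of a subgradient of `ℓ t ω` at each point `θ` of the unit `ℓ¹`-ball. Both are revealed
at time `t`, that is, adapted to the filtration `ℱ`, and the losses have a finite expectation, so
that the conditional risks make sense. -/
structure IsLossSequence {Ω : Type*} {mΩ : MeasurableSpace Ω} {d : ℕ} (μ : Measure Ω)
    (ℱ : Filtration ℕ mΩ) (ℓ : ℕ → Ω → (Fin d → ℝ) → ℝ)
    (grad : ℕ → Ω → (Fin d → ℝ) → (Fin d → ℝ)) : Prop where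
  convex : ∀ t, 1 ≤ t → ∀ ω, ConvexOn ℝ Set.univ (ℓ t ω)
  subgradient : ∀ t, 1 ≤ t → ∀ ω, ∀ θ ∈ l1Ball d, IsSubgradientAt (ℓ t ω) (grad t ω θ) θ
  measurable_loss : ∀ t, 1 ≤ t → ∀ θ : Fin d → ℝ, Measurable[ℱ t] (fun ω => ℓ t ω θ)
  measurable_grad : ∀ t, 1 ≤ t →
    Measurable[(ℱ t).prod MeasurableSpace.pi]
      (fun p : Ω × (Fin d → ℝ) => grad t p.1 p.2)
  integrable_loss : ∀ t, 1 ≤ t → ∀ θ ∈ l1Ball d, Integrable (fun ω => ℓ t ω θ) μ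

/-- Lipschitz losses: almost surely, the sup norm of the subgradients on the unit `ℓ¹`-ball is at
most `G`. -/
def LipschitzLoss {Ω : Type*} {mΩ : MeasurableSpace Ω} {d : ℕ} (μ : Measure Ω)
    (grad : ℕ → Ω → (Fin d → ℝ) → (Fin d → ℝ)) (G : ℝ) : Prop :=
  ∀ t, 1 ≤ t → ∀ᵐ ω ∂μ, ∀ θ ∈ l1Ball d, ‖grad t ω θ‖ ≤ G

/-- The power `u ^ (1/β)` for `u ≥ 0`. For `β = 0` it is the limit as `β → 0⁺` for `u < 1`, namely
`0`; the limit is infinite for `u > 1`, which `WeakExpConcave` rules out separately. -/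
def invPow (u β : ℝ) : ℝ :=
  if β = 0 then 0 else u ^ (1 / β)

/-- Weak exp-concavity with parameters `α, β`: for all `t ≥ 1` and `θ₁, θ₂` in the unit `ℓ¹`-ball,
almost surely
`E_{t-1}[ℓ_t θ₁ - ℓ_t θ₂] ≤ E_{t-1}[∇ℓ_t(θ₁)ᵀ(θ₁-θ₂)] - E_{t-1}[(α (∇ℓ_t(θ₁)ᵀ(θ₁-θ₂))²)^(1/β)]`.
For `β = 0` the exponent is `+∞`; the last expectation is finite only if the base is almost surely
at most one. -/
def WeakExpConcave {Ω : Type*} {mΩ : MeasurableSpace Ω} {d : ℕ} (μ : Measure Ω)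
    (ℱ : Filtration ℕ mΩ) (ℓ : ℕ → Ω → (Fin d → ℝ) → ℝ)
    (grad : ℕ → Ω → (Fin d → ℝ) → (Fin d → ℝ)) (α β : ℝ) : Prop :=
  ∀ t, 1 ≤ t → ∀ θ₁ ∈ l1Ball d, ∀ θ₂ ∈ l1Ball d,
    (β = 0 → ∀ᵐ ω ∂μ, α * (grad t ω θ₁ ⬝ᵥ (θ₁ - θ₂)) ^ 2 ≤ 1) ∧
    ∀ᵐ ω ∂μ,
      (μ[fun ω' => ℓ t ω' θ₁ - ℓ t ω' θ₂ | ℱ (t - 1)]) ω ≤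
        (μ[fun ω' => grad t ω' θ₁ ⬝ᵥ (θ₁ - θ₂) | ℱ (t - 1)]) ω -
          (μ[fun ω' => invPow (α * (grad t ω' θ₁ ⬝ᵥ (θ₁ - θ₂)) ^ 2) β | ℱ (t - 1)]) ω

/-- The learning rates `η_i = (e^i E)⁻¹`. -/
def learningRate (E : ℝ) (i : ℕ) : ℝ :=
  (Real.exp i * E)⁻¹

/-- The indices `1 ≤ i ≤ log (E T)` of the learning rates in use. -/
def rateIndices (E : ℝ) (T : ℕ) : Finset ℕ :=
  Finset.Icc 1 ⌊Real.log (E * T)⌋₊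

/-- The weight of the `k`-th point, when `L η k` is the value of `∑ s ≤ t, (r_{k,s} - η r_{k,s}²)`. -/
def boaWeight {K : ℕ} (E : ℝ) (T : ℕ) (prior : Fin K → ℝ) (L : ℝ → Fin K → ℝ) (k : Fin K) : ℝ :=
  (∑ i ∈ rateIndices E T, learningRate E i *
      Real.exp (learningRate E i * L (learningRate E i) k) * prior k) /
    ∑ i ∈ rateIndices E T, ∑ j, prior j * (learningRate E i *
      Real.exp (learningRate E i * L (learningRate E i) j))

/-- The prediction `∑ k, π̂_k θ_k` made with the weights of `boaWeight`. -/
def boaPredict {d K : ℕ} (E : ℝ) (T : ℕ) (prior : Fin K → ℝ) (θ : Fin K → Fin d → ℝ)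
    (L : ℝ → Fin K → ℝ) : Fin d → ℝ :=
  ∑ k, boaWeight E T prior L k • θ k

/-- `boaCum E T prior θ g t η k` is `∑ s ≤ t, (r_{k,s} - η r_{k,s}²)` along the run of the algorithm
against the subgradients `g s`, where `r_{k,s} = g_s(θ̂_{s-1})ᵀ(θ̂_{s-1} - θ_k)`. -/
def boaCum {d K : ℕ} (E : ℝ) (T : ℕ) (prior : Fin K → ℝ) (θ : Fin K → Fin d → ℝ)
    (g : ℕ → (Fin d → ℝ) → (Fin d → ℝ)) : ℕ → ℝ → Fin K → ℝ
  | 0 => fun _ _ => 0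
  | t + 1 => fun η k =>
      let p := boaPredict E T prior θ (boaCum E T prior θ g t)
      let r := g (t + 1) p ⬝ᵥ (p - θ k)
      boaCum E T prior θ g t η k + (r - η * r ^ 2)

/-- The prediction `θ̂_t` of the algorithm, made after `t` rounds. -/
def boaIterate {d K : ℕ} (E : ℝ) (T : ℕ) (prior : Fin K → ℝ) (θ : Fin K → Fin d → ℝ)
    (g : ℕ → (Fin d → ℝ) → (Fin d → ℝ)) (t : ℕ) : Fin d → ℝ :=
  boaPredict E T prior θ (boaCum E T prior θ g t)

/-- The average risk `R_T(θ)` of the predictions `pred t ω = θ̂_t`, namely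
`(1/T) ∑_{t=1}^T E_{t-1}[ℓ_t(θ̂_{t-1})] - (1/T) ∑_{t=1}^T E_{t-1}[ℓ_t(θ)]`. -/
def avgRisk {Ω : Type*} {mΩ : MeasurableSpace Ω} {d : ℕ} (μ : Measure Ω)
    (ℱ : Filtration ℕ mΩ) (ℓ : ℕ → Ω → (Fin d → ℝ) → ℝ)
    (pred : ℕ → Ω → (Fin d → ℝ)) (T : ℕ) (θ : Fin d → ℝ) (ω : Ω) : ℝ :=
  (1 / (T : ℝ)) * ∑ t ∈ Finset.Icc 1 T, (μ[fun ω' => ℓ t ω' (pred (t - 1) ω') | ℱ (t - 1)]) ω -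
    (1 / (T : ℝ)) * ∑ t ∈ Finset.Icc 1 T, (μ[fun ω' => ℓ t ω' θ | ℱ (t - 1)]) ω

/-- The Kullback-Leibler divergence `∑ k, π_k log (π_k / ρ_k)`, to be used when `ρ_k = 0` implies
`π_k = 0`; it is infinite otherwise. -/
def klFin {K : ℕ} (π ρ : Fin K → ℝ) : ℝ :=
  ∑ k, π k * Real.log (π k / ρ k)

end OnlineBOA

end

namespace OnlineBOA

/-! ### Scalar inequalities -/

/-! Write `r` for the linearized regret of a round and, after averaging over `π` and summing over
rounds, let `Q`, `V`, `R` be the conditional first moment of `r`, its conditional second moment, and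
the conditional regret. Convexity gives `R ≤ Q`; the gap `S = Q - R` pays for the variance.

Two exponential arguments bound `Q`. Pathwise, the potential `∑ᵢ ∑ₖ prior k * exp (ηᵢ ∑ (r - ηᵢ
r²))` never increases: `exp (y - y²) ≤ 1 + y`, and the weights cancel the first-order term
(`boaPotential_succ_le`). Stochastically, `exp (-y + y²)` compensated by the conditional moments of
`y = η r` has integral at most one (`integral_expProcess_le_one`). Gibbs' variational inequality
`sum_mul_le_klFin_add_log` turns each bound into one valid for all `π` at once, so the random event
does not depend on `π`. In the sum of the two the realized terms `η r - η² r²` cancel, leaving `η Q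
≤ 4 η² V + 2 (KL + log N) + x` for each of the `N` rates (`exists_event`).

Weak exp-concavity, through `le_add_invPow`, gives `V ≤ κ S + T c ^ β / α` with `κ` of order `c ^ (β
- 1) / α + G`. A rate `η` of order `1 / κ` lets `4 η V` be absorbed by `S`, and `c = (a / (α T)) ^
(1 / (2 - β))` balances the remaining terms (`sub_le_of_tuning`).

The delicate point is that exp-concavity holds almost surely only at each fixed point, whereas the
prediction is random and subgradients may be discontinuous. The prediction is moved slightly towards
the comparator and rounded to countably many values; monotonicity of subgradients controls the
change in the one direction needed (`linearized_le_of_near`). This adds `4 G` to `κ`, hence a term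
of order `G a / T` to the risk. -/

lemma exp_sub_sq_le_one_add {y : ℝ} (hy : |y| ≤ 0.56) : Real.exp (y - y ^ 2) ≤ 1 + y := by
  obtain ⟨h1, h2⟩ := abs_le.mp hy
  have hpos : 0 < 1 + y := by linarith
  rcases le_total 0 y with h0 | h0
  · rw [← Real.le_log_iff_exp_le hpos]
    refine le_trans ?_ (Real.one_sub_inv_le_log_of_pos hpos)
    have : 1 - (1 + y)⁻¹ = y / (1 + y) := by field_simp; ring
    rw [this, le_div_iff₀ hpos]
    nlinarith [pow_nonneg h0 3]
  · obtain ⟨w, rfl⟩ : ∃ w, y = -w := ⟨-y, by ring⟩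
    have hw0 : 0 ≤ w := by linarith
    have hw1 : w ≤ 0.56 := by linarith
    have hu : 0 ≤ w + w ^ 2 := by positivity
    have hexp := Real.sum_le_exp_of_nonneg hu 4
    simp only [Finset.sum_range_succ, Finset.sum_range_zero, Nat.factorial] at hexp
    norm_num at hexp
    -- The cubic Taylor lower bound for `exp` leaves an excess of `w ^ 2` times a polynomial that is
    -- nonnegative on `[0, 0.56]`.
    have hkey : 1 ≤ (1 - w) * Real.exp (w + w ^ 2) := by
      have h3 : 0 ≤ -w + (1 - w) * (1 + w) ^ 2 / 2 + (1 - w) * w * (1 + w) ^ 3 / 6 := by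
        have hA : 0 ≤ w ^ 2 * (1 - w) := by
          apply mul_nonneg (sq_nonneg w); linarith
        have hB : 0 ≤ w * (0.56 - w) := mul_nonneg hw0 (by linarith)
        have hC : 0 ≤ w ^ 2 * (0.56 - w) := mul_nonneg (sq_nonneg w) (by linarith)
        have hD : 0 ≤ w ^ 3 * (0.56 - w) := mul_nonneg (pow_nonneg hw0 3) (by linarith)
        have hE : 0 ≤ w ^ 4 * (0.56 - w) := mul_nonneg (pow_nonneg hw0 4) (by linarith)
        nlinarith [pow_nonneg hw0 3, pow_nonneg hw0 2, pow_nonneg hw0 4]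
      have h4 : 1 ≤ (1 - w) * (1 + (w + w ^ 2) + (w + w ^ 2) ^ 2 / 2 + (w + w ^ 2) ^ 3 / 6) := by
        have : (1 - w) * (1 + (w + w ^ 2) + (w + w ^ 2) ^ 2 / 2 + (w + w ^ 2) ^ 3 / 6) - 1 =
          w ^ 2 * (-w + (1 - w) * (1 + w) ^ 2 / 2 + (1 - w) * w * (1 + w) ^ 3 / 6) := by ring
        nlinarith [mul_nonneg (sq_nonneg w) h3]
      refine h4.trans (mul_le_mul_of_nonneg_left ?_ (by linarith))
      linarith
    have he : -w - (-w) ^ 2 = -(w + w ^ 2) := by ring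
    rw [he, Real.exp_neg, inv_le_iff_one_le_mul₀ (Real.exp_pos _)]
    linarith

/-- Apply `exp z ≤ 1 + z + z²` to `z = -y + y²`. Here `z² = (1 - y)² y² ≤ 3 y²`, and the linear part
contributes one more `y²`, whence the 4. -/
lemma exp_neg_add_sq_le {y : ℝ} (hy : |y| ≤ 0.56) :
    Real.exp (-y + y ^ 2) ≤ 1 - y + 4 * y ^ 2 := by
  obtain ⟨h1, h2⟩ := abs_le.mp hy
  have h3 : |-y + y ^ 2| ≤ 1 := by
    rw [abs_le]; constructor <;> nlinarith
  have h4 := (abs_le.mp (Real.abs_exp_sub_one_sub_id_le h3)).2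
  have h5 : (-y + y ^ 2) ^ 2 ≤ 3 * y ^ 2 := by
    have : (-y + y ^ 2) ^ 2 = (1 - y) ^ 2 * y ^ 2 := by ring
    rw [this]
    exact mul_le_mul_of_nonneg_right (by nlinarith) (sq_nonneg y)
  linarith

/-- Splitting `u` according to whether `u ^ (1 / β)` exceeds `c`. -/
lemma le_add_invPow {u β c : ℝ} (hu : 0 ≤ u) (hβ : 0 ≤ β) (hβ1 : β ≤ 1) (hc : 0 < c)
    (h0 : β = 0 → u ≤ 1) : u ≤ c ^ (β - 1) * invPow u β + c ^ β := by
  unfold invPow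
  split_ifs with hb
  -- For `β = 0` the right-hand side is `c ^ 0 = 1`, so the separate bound on the base is exactly
  -- what is needed.
  · subst hb; simpa using h0 rfl
  · have hz : 0 ≤ u ^ (1 / β) := Real.rpow_nonneg hu _
    have huz : u = (u ^ (1 / β)) ^ β := by
      rw [← Real.rpow_mul hu, one_div, inv_mul_cancel₀ hb, Real.rpow_one]
    set z := u ^ (1 / β)
    rcases le_total z c with h | h
    · have := Real.rpow_le_rpow hz h hβ
      have h2 : 0 ≤ c ^ (β - 1) * z := by positivity
      linarith
    · have hz' : 0 < z := hc.trans_le h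
      have h1 : z ^ (β - 1) ≤ c ^ (β - 1) := Real.rpow_le_rpow_of_nonpos hc h (by linarith)
      have h2 : z ^ β = z ^ (β - 1) * z := by
        rw [← Real.rpow_add_one hz'.ne']; congr 1; ring
      have h3 : 0 ≤ c ^ β := by positivity
      rw [huz, h2]
      nlinarith [mul_le_mul_of_nonneg_right h1 hz]

/-! ### The Kullback-Leibler divergence -/

lemma exists_pos_of_mem_stdSimplex {K : ℕ} {π : Fin K → ℝ} (hπ : π ∈ stdSimplex ℝ (Fin K)) :
    ∃ k, 0 < π k := by
  by_contra! h
  have h1 := Finset.sum_nonpos fun k (_ : k ∈ Finset.univ) => h k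
  have h2 := hπ.2
  linarith

/-- Gibbs (Donsker–Varadhan) variational inequality: apply `log s ≤ s - 1` to `s = ρ k * exp (f k) /
(π k * Z)`, weight by `π k` and sum; the right-hand sides sum to zero. -/
lemma sum_mul_le_klFin_add_log {K : ℕ} {π ρ : Fin K → ℝ} (hπ : π ∈ stdSimplex ℝ (Fin K))
    (hρ : ∀ k, 0 ≤ ρ k) (hac : ∀ k, ρ k = 0 → π k = 0) (f : Fin K → ℝ) :
    ∑ k, π k * f k ≤ klFin π ρ + Real.log (∑ k, ρ k * Real.exp (f k)) := by
  set Z := ∑ k, ρ k * Real.exp (f k) with hZ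
  have hnn : ∀ k, 0 ≤ ρ k * Real.exp (f k) := fun k => mul_nonneg (hρ k) (Real.exp_pos _).le
  have hZpos : 0 < Z := by
    obtain ⟨k, hk⟩ := exists_pos_of_mem_stdSimplex hπ
    have hk' : 0 < ρ k := lt_of_le_of_ne (hρ k) fun h => hk.ne' (hac k h.symm)
    exact Finset.sum_pos' (fun k _ => hnn k)
      ⟨k, Finset.mem_univ _, mul_pos hk' (Real.exp_pos _)⟩
  have hterm : ∀ k, π k * f k - π k * Real.log (π k / ρ k) - π k * Real.log Z ≤
      ρ k * Real.exp (f k) / Z - π k := by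
    intro k
    rcases (hπ.1 k).eq_or_lt with h0 | hpos
    · rw [← h0]; simpa using div_nonneg (hnn k) hZpos.le
    · have hk' : 0 < ρ k := lt_of_le_of_ne (hρ k) fun h => hpos.ne' (hac k h.symm)
      have hu : 0 < ρ k * Real.exp (f k) / (π k * Z) := by positivity
      have h1 := Real.log_le_sub_one_of_pos hu
      rw [Real.log_div (by positivity) (by positivity), Real.log_mul hk'.ne' (Real.exp_ne_zero _),
        Real.log_exp, Real.log_mul hpos.ne' hZpos.ne'] at h1
      rw [Real.log_div hpos.ne' hk'.ne']
      have h2 := mul_le_mul_of_nonneg_left h1 hpos.le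
      have h3 : π k * (ρ k * Real.exp (f k) / (π k * Z) - 1) = ρ k * Real.exp (f k) / Z - π k := by
        field_simp
      rw [h3] at h2
      linarith
  have hsum := Finset.sum_le_sum fun k (_ : k ∈ Finset.univ) => hterm k
  simp only [Finset.sum_sub_distrib, ← Finset.sum_div, ← Finset.sum_mul, hπ.2, ← hZ,
    div_self hZpos.ne'] at hsum
  unfold klFin
  linarith

lemma sum_mul_le_klFin_add_log_of_le {K : ℕ} {π ρ : Fin K → ℝ} (hπ : π ∈ stdSimplex ℝ (Fin K))
    (hρ : ρ ∈ stdSimplex ℝ (Fin K)) (hac : ∀ k, ρ k = 0 → π k = 0) (f : Fin K → ℝ) {Z : ℝ}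
    (hZ : ∑ k, ρ k * Real.exp (f k) ≤ Z) :
    ∑ k, π k * f k ≤ klFin π ρ + Real.log Z := by
  obtain ⟨k, hk⟩ := exists_pos_of_mem_stdSimplex hρ
  have hpos : 0 < ∑ k, ρ k * Real.exp (f k) :=
    Finset.sum_pos' (fun k _ => mul_nonneg (hρ.1 k) (Real.exp_pos _).le)
      ⟨k, Finset.mem_univ _, by positivity⟩
  have := sum_mul_le_klFin_add_log hπ hρ.1 hac f
  have := Real.log_le_log hpos hZ
  linarith

lemma klFin_nonneg {K : ℕ} {π ρ : Fin K → ℝ} (hπ : π ∈ stdSimplex ℝ (Fin K))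
    (hρ : ρ ∈ stdSimplex ℝ (Fin K)) (hac : ∀ k, ρ k = 0 → π k = 0) : 0 ≤ klFin π ρ := by
  have := sum_mul_le_klFin_add_log hπ hρ.1 hac 0
  simpa [hρ.2] using this

/-! ### The unit `ℓ¹`-ball -/

lemma abs_dotProduct_le_norm_mul_sum {d : ℕ} (g v : Fin d → ℝ) :
    |g ⬝ᵥ v| ≤ ‖g‖ * ∑ i, |v i| := by
  unfold dotProduct
  refine (Finset.abs_sum_le_sum_abs _ _).trans ?_
  rw [Finset.mul_sum]
  refine Finset.sum_le_sum fun i _ => ?_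
  rw [abs_mul]
  exact mul_le_mul_of_nonneg_right (norm_le_pi_norm g i) (abs_nonneg _)

lemma convex_l1Ball (d : ℕ) : Convex ℝ (l1Ball d) := by
  intro u hu v hv a b ha hb hab
  simp only [l1Ball, Set.mem_ofPred_eq] at *
  calc ∑ i, |(a • u + b • v) i| ≤ ∑ i, (a * |u i| + b * |v i|) := by
        refine Finset.sum_le_sum fun i _ => ?_
        simp only [Pi.add_apply, Pi.smul_apply, smul_eq_mul]
        refine (abs_add_le _ _).trans ?_
        rw [abs_mul, abs_mul, abs_of_nonneg ha, abs_of_nonneg hb]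
    _ = a * ∑ i, |u i| + b * ∑ i, |v i| := by
        rw [Finset.sum_add_distrib, Finset.mul_sum, Finset.mul_sum]
    _ ≤ 1 := by nlinarith

lemma zero_mem_l1Ball (d : ℕ) : (0 : Fin d → ℝ) ∈ l1Ball d := by simp [l1Ball]

lemma sum_abs_sub_le_two {d : ℕ} {u v : Fin d → ℝ} (hu : u ∈ l1Ball d) (hv : v ∈ l1Ball d) :
    ∑ i, |(u - v) i| ≤ 2 := by
  simp only [l1Ball, Set.mem_ofPred_eq] at *
  calc ∑ i, |(u - v) i| ≤ ∑ i, (|u i| + |v i|) :=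
        Finset.sum_le_sum fun i _ => abs_sub _ _
    _ ≤ 2 := by rw [Finset.sum_add_distrib]; linarith

lemma abs_dotProduct_sub_le {d : ℕ} {g u v : Fin d → ℝ} {G : ℝ} (hg : ‖g‖ ≤ G)
    (hu : u ∈ l1Ball d) (hv : v ∈ l1Ball d) : |g ⬝ᵥ (u - v)| ≤ 2 * G := by
  refine (abs_dotProduct_le_norm_mul_sum _ _).trans ?_
  have := sum_abs_sub_le_two hu hv
  nlinarith [norm_nonneg g, Finset.sum_nonneg fun i (_ : i ∈ Finset.univ) => abs_nonneg ((u - v) i)]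

/-! ### Learning rates -/

lemma learningRate_pos {E : ℝ} (hE : 0 < E) (i : ℕ) : 0 < learningRate E i := by
  unfold learningRate; positivity

/-- The largest rate has `i = 1`, so the product is at most `2 G / (e * 4 G / 3) = 1.5 / e`. This is
where `E = 4 G / 3` and the threshold `0.56` of the scalar inequalities meet. -/
lemma abs_learningRate_mul_le {G r : ℝ} (hG : 0 < G) {i : ℕ} (hi : 1 ≤ i) (hr : |r| ≤ 2 * G) :
    |learningRate (4 * G / 3) i * r| ≤ 0.56 := by
  have hE : 0 < 4 * G / 3 := by positivity
  rw [abs_mul, abs_of_pos (learningRate_pos hE i)]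
  have h1 : (2.7 : ℝ) ≤ Real.exp i := by
    have := Real.exp_one_gt_d9
    have h2 : Real.exp 1 ≤ Real.exp i := Real.exp_le_exp.mpr (by exact_mod_cast hi)
    linarith
  have h2 : learningRate (4 * G / 3) i ≤ (2.7 * (4 * G / 3))⁻¹ := by
    unfold learningRate
    exact inv_anti₀ (by positivity) (mul_le_mul_of_nonneg_right h1 hE.le)
  calc learningRate (4 * G / 3) i * |r| ≤ (2.7 * (4 * G / 3))⁻¹ * (2 * G) :=
        mul_le_mul h2 hr (abs_nonneg _) (by positivity)
    _ = 1.5 / 2.7 := by field_simp; norm_num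
    _ ≤ 0.56 := by norm_num

/-! ### The deterministic regret bound of the algorithm -/

section Deterministic

variable {d K : ℕ} {E : ℝ} {T : ℕ} {prior : Fin K → ℝ} {θ : Fin K → Fin d → ℝ}

/-- The unnormalized weight of the `k`-th point. -/
noncomputable def boaMass {K : ℕ} (E : ℝ) (T : ℕ) (prior : Fin K → ℝ) (L : ℝ → Fin K → ℝ) (k : Fin K) : ℝ :=
  ∑ i ∈ rateIndices E T, learningRate E i *
      Real.exp (learningRate E i * L (learningRate E i) k) * prior k

lemma boaWeight_eq (L : ℝ → Fin K → ℝ) (k : Fin K) :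
    boaWeight E T prior L k = boaMass E T prior L k / ∑ j, boaMass E T prior L j := by
  unfold boaWeight boaMass
  rw [Finset.sum_comm (s := Finset.univ)]
  congr 1
  exact Finset.sum_congr rfl fun i _ => Finset.sum_congr rfl fun j _ => by ring

lemma boaMass_nonneg (hE : 0 < E) (hprior : ∀ k, 0 ≤ prior k) (L : ℝ → Fin K → ℝ) (k : Fin K) :
    0 ≤ boaMass E T prior L k :=
  Finset.sum_nonneg fun i _ =>
    mul_nonneg (mul_nonneg (learningRate_pos hE i).le (Real.exp_pos _).le) (hprior k)

lemma sum_boaMass_pos (hE : 0 < E) (hgrid : 1 ≤ Real.log (E * T))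
    (hprior : prior ∈ stdSimplex ℝ (Fin K)) (L : ℝ → Fin K → ℝ) :
    0 < ∑ k, boaMass E T prior L k := by
  obtain ⟨k, hk⟩ := exists_pos_of_mem_stdSimplex hprior
  refine Finset.sum_pos' (fun k _ => boaMass_nonneg hE hprior.1 L k) ⟨k, Finset.mem_univ _, ?_⟩
  refine Finset.sum_pos (fun i _ => ?_) ⟨1, ?_⟩
  · have := learningRate_pos hE i
    positivity
  · simp only [rateIndices, Finset.mem_Icc, le_refl, true_and]
    exact (Nat.one_le_floor_iff _).mpr hgrid

lemma boaPredict_mem_l1Ball (hE : 0 < E) (hgrid : 1 ≤ Real.log (E * T))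
    (hprior : prior ∈ stdSimplex ℝ (Fin K)) (hθ : ∀ k, θ k ∈ l1Ball d) (L : ℝ → Fin K → ℝ) :
    boaPredict E T prior θ L ∈ l1Ball d := by
  have hpos := sum_boaMass_pos hE hgrid hprior L
  refine (convex_l1Ball d).sum_mem (fun k _ => ?_) ?_ fun k _ => hθ k
  · rw [boaWeight_eq]
    exact div_nonneg (boaMass_nonneg hE hprior.1 L k) hpos.le
  · simp only [boaWeight_eq]
    rw [← Finset.sum_div, div_self hpos.ne']

/-- The weights make the linearized losses of the points average to zero. -/
lemma sum_boaMass_mul_dotProduct (hE : 0 < E) (hgrid : 1 ≤ Real.log (E * T))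
    (hprior : prior ∈ stdSimplex ℝ (Fin K)) (L : ℝ → Fin K → ℝ) (g : Fin d → ℝ) :
    ∑ k, boaMass E T prior L k * (g ⬝ᵥ (boaPredict E T prior θ L - θ k)) = 0 := by
  have hpos := sum_boaMass_pos hE hgrid hprior L
  set W := ∑ k, boaMass E T prior L k with hW
  have hp : g ⬝ᵥ boaPredict E T prior θ L =
      (∑ k, boaMass E T prior L k * (g ⬝ᵥ θ k)) / W := by
    unfold boaPredict
    rw [dotProduct_sum, Finset.sum_div]
    refine Finset.sum_congr rfl fun k _ => ?_
    rw [dotProduct_smul, boaWeight_eq, smul_eq_mul]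
    ring
  simp only [dotProduct_sub, mul_sub, Finset.sum_sub_distrib]
  rw [← Finset.sum_mul, ← hW, hp]
  field_simp
  ring

/-- The potential of the algorithm. -/
noncomputable def boaPotential {K : ℕ} (E : ℝ) (T : ℕ) (prior : Fin K → ℝ) (L : ℝ → Fin K → ℝ) : ℝ :=
  ∑ i ∈ rateIndices E T, ∑ k, prior k * Real.exp (learningRate E i * L (learningRate E i) k)

/-- Each exponential is multiplied by `exp (η r - (η r)²) ≤ 1 + η r`. The factor `η` in the weights
makes the total first-order change `∑ₖ boaMass k * r k`, which vanishes by the choice of the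
prediction. -/
lemma boaPotential_succ_le {G : ℝ} (hG : 0 < G) (hgrid : 1 ≤ Real.log (4 * G / 3 * T))
    (hprior : prior ∈ stdSimplex ℝ (Fin K)) (hθ : ∀ k, θ k ∈ l1Ball d)
    (g : ℕ → (Fin d → ℝ) → (Fin d → ℝ)) (t : ℕ) (hg : ∀ v ∈ l1Ball d, ‖g (t + 1) v‖ ≤ G) :
    boaPotential (4 * G / 3) T prior (boaCum (4 * G / 3) T prior θ g (t + 1)) ≤
      boaPotential (4 * G / 3) T prior (boaCum (4 * G / 3) T prior θ g t) := by
  have hE : 0 < 4 * G / 3 := by positivity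
  set E := 4 * G / 3 with hEdef
  set L := boaCum E T prior θ g t with hL
  set p := boaPredict E T prior θ L with hp
  have hpB : p ∈ l1Ball d := boaPredict_mem_l1Ball hE hgrid hprior hθ L
  have hzero := sum_boaMass_mul_dotProduct (θ := θ) hE hgrid hprior L (g (t + 1) p)
  have hstep : boaPotential E T prior (boaCum E T prior θ g (t + 1)) ≤
      boaPotential E T prior L +
        ∑ k, boaMass E T prior L k * (g (t + 1) p ⬝ᵥ (p - θ k)) := by
    unfold boaPotential boaMass
    simp only [Finset.sum_mul]
    rw [Finset.sum_comm (s := Finset.univ), ← Finset.sum_add_distrib]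
    refine Finset.sum_le_sum fun i hi => ?_
    rw [← Finset.sum_add_distrib]
    refine Finset.sum_le_sum fun k _ => ?_
    have hi1 : 1 ≤ i := (Finset.mem_Icc.mp hi).1
    set η := learningRate E i
    set r := g (t + 1) p ⬝ᵥ (p - θ k) with hr
    have hcum : boaCum E T prior θ g (t + 1) η k = L η k + (r - η * r ^ 2) := rfl
    have hy := exp_sub_sq_le_one_add
      (abs_learningRate_mul_le hG hi1 (abs_dotProduct_sub_le (hg p hpB) hpB (hθ k)))
    rw [hcum]
    have hexp : Real.exp (η * (L η k + (r - η * r ^ 2))) =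
        Real.exp (η * L η k) * Real.exp (η * r - (η * r) ^ 2) := by
      rw [← Real.exp_add]; congr 1; ring
    rw [hexp]
    have h1 : 0 ≤ prior k * Real.exp (η * L η k) :=
      mul_nonneg (hprior.1 k) (Real.exp_pos _).le
    change Real.exp (η * r - (η * r) ^ 2) ≤ 1 + η * r at hy
    nlinarith [mul_le_mul_of_nonneg_left hy h1]
  rw [hzero, add_zero] at hstep
  exact hstep

lemma boaPotential_le_card {G : ℝ} (hG : 0 < G) (hgrid : 1 ≤ Real.log (4 * G / 3 * T))
    (hprior : prior ∈ stdSimplex ℝ (Fin K)) (hθ : ∀ k, θ k ∈ l1Ball d)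
    (g : ℕ → (Fin d → ℝ) → (Fin d → ℝ))
    (hg : ∀ t, 1 ≤ t → ∀ v ∈ l1Ball d, ‖g t v‖ ≤ G) (t : ℕ) :
    boaPotential (4 * G / 3) T prior (boaCum (4 * G / 3) T prior θ g t) ≤
      (rateIndices (4 * G / 3) T).card := by
  induction t with
  | zero => simp [boaPotential, boaCum, hprior.2]
  | succ t ih =>
    exact (boaPotential_succ_le hG hgrid hprior hθ g t (hg _ (by omega))).trans ih

lemma boaCum_eq_sum (g : ℕ → (Fin d → ℝ) → (Fin d → ℝ)) (t : ℕ) (η : ℝ) (k : Fin K) :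
    boaCum E T prior θ g t η k =
      ∑ s ∈ Finset.Icc 1 t,
        ((g s (boaIterate E T prior θ g (s - 1)) ⬝ᵥ (boaIterate E T prior θ g (s - 1) - θ k)) -
        η * (g s (boaIterate E T prior θ g (s - 1)) ⬝ᵥ
          (boaIterate E T prior θ g (s - 1) - θ k)) ^ 2) := by
  induction t with
  | zero => simp [boaCum]
  | succ t ih =>
    rw [Finset.sum_Icc_succ_top (by omega), ← ih]
    rfl

/-- The second-order regret bound of the algorithm, for each learning rate of the grid. -/
lemma sum_mul_boaCum_le {G : ℝ} (hG : 0 < G) (hgrid : 1 ≤ Real.log (4 * G / 3 * T))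
    (hprior : prior ∈ stdSimplex ℝ (Fin K)) (hθ : ∀ k, θ k ∈ l1Ball d)
    (g : ℕ → (Fin d → ℝ) → (Fin d → ℝ))
    (hg : ∀ t, 1 ≤ t → ∀ v ∈ l1Ball d, ‖g t v‖ ≤ G) (t : ℕ)
    {i : ℕ} (hi : i ∈ rateIndices (4 * G / 3) T) {π : Fin K → ℝ}
    (hπ : π ∈ stdSimplex ℝ (Fin K)) (hac : ∀ k, prior k = 0 → π k = 0) :
    ∑ k, π k * (learningRate (4 * G / 3) i *
      boaCum (4 * G / 3) T prior θ g t (learningRate (4 * G / 3) i) k) ≤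
      klFin π prior + Real.log (rateIndices (4 * G / 3) T).card := by
  refine sum_mul_le_klFin_add_log_of_le hπ hprior hac _ ?_
  refine le_trans ?_ (boaPotential_le_card hG hgrid hprior hθ g hg t)
  exact Finset.single_le_sum (f := fun i => ∑ k, prior k * Real.exp (learningRate (4 * G / 3) i *
    boaCum (4 * G / 3) T prior θ g t (learningRate (4 * G / 3) i) k))
    (fun i _ => Finset.sum_nonneg fun k _ => mul_nonneg (hprior.1 k) (Real.exp_pos _).le) hi

end Deterministic

/-! ### Conditional expectations at a random point -/

/-- Conditional expectation is local: on the `m`-measurable set `{X = v}` the random point may be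
replaced by `v`. Countability of the range keeps the union of exceptional sets null. -/
lemma condExp_comp_nonpos {Ω V : Type*} {m mΩ : MeasurableSpace Ω} [MeasurableSpace V]
    [MeasurableSingletonClass V] {μ : Measure Ω} {F : Ω → V → ℝ} {X : Ω → V}
    (hX : Measurable[m] X) (hcount : (Set.range X).Countable)
    (hint : Integrable (fun ω => F ω (X ω)) μ)
    (hF : ∀ v ∈ Set.range X, Integrable (fun ω => F ω v) μ)
    (hle : ∀ v ∈ Set.range X, ∀ᵐ ω ∂μ, (μ[fun ω' => F ω' v | m]) ω ≤ 0) :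
    ∀ᵐ ω ∂μ, (μ[fun ω' => F ω' (X ω') | m]) ω ≤ 0 := by
  have hall : ∀ᵐ ω ∂μ, ∀ v ∈ Set.range X, X ω = v → (μ[fun ω' => F ω' (X ω') | m]) ω ≤ 0 := by
    rw [ae_ball_iff hcount]
    intro v hv
    have hA : MeasurableSet[m] (X ⁻¹' {v}) := hX (measurableSet_singleton v)
    have h1 := condExp_indicator (m := m) hint hA
    have h2 := condExp_indicator (m := m) (hF v hv) hA
    have heq : (X ⁻¹' {v}).indicator (fun ω => F ω (X ω)) =
        (X ⁻¹' {v}).indicator (fun ω => F ω v) := by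
      refine Set.indicator_congr fun ω hω => ?_
      have : X ω = v := hω
      simp only [this]
    rw [heq] at h1
    filter_upwards [h1, h2, hle v hv] with ω e1 e2 e3 hω
    have hmem : ω ∈ X ⁻¹' {v} := hω
    rw [Set.indicator_of_mem hmem] at e1 e2
    rw [← e1, e2]
    exact e3
  filter_upwards [hall] with ω h
  exact h (X ω) ⟨ω, rfl⟩ rfl

/-- Rounding towards zero to a multiple of `1 / n`. -/
noncomputable def roundToZero (n : ℕ) (x : ℝ) : ℝ :=
  if 0 ≤ x then (⌊n * x⌋ : ℝ) / n else (⌈n * x⌉ : ℝ) / n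

lemma measurable_roundToZero (n : ℕ) : Measurable (roundToZero n) := by
  unfold roundToZero
  refine Measurable.ite measurableSet_Ici ?_ ?_
  · exact ((measurable_of_countable (fun z : ℤ => (z : ℝ))).comp
      (Int.measurable_floor.comp (measurable_const.mul measurable_id))).div_const _
  · exact ((measurable_of_countable (fun z : ℤ => (z : ℝ))).comp
      (Int.measurable_ceil.comp (measurable_const.mul measurable_id))).div_const _

lemma exists_roundToZero_eq (n : ℕ) (x : ℝ) : ∃ z : ℤ, (z : ℝ) / n = roundToZero n x := by
  unfold roundToZero
  split_ifs
  exacts [⟨_, rfl⟩, ⟨_, rfl⟩]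

/-- Rounding towards zero, unlike rounding to the nearest multiple, never leaves the `ℓ¹`-ball. -/
lemma abs_roundToZero_le {n : ℕ} (hn : 0 < n) (x : ℝ) : |roundToZero n x| ≤ |x| := by
  have hn' : (0 : ℝ) < n := by exact_mod_cast hn
  unfold roundToZero
  split_ifs with h
  · have h1 : 0 ≤ (⌊n * x⌋ : ℝ) := by exact_mod_cast Int.floor_nonneg.mpr (by positivity)
    rw [abs_of_nonneg h, abs_of_nonneg (by positivity), div_le_iff₀ hn', mul_comm]
    exact Int.floor_le _
  · have h0 : x < 0 := not_le.mp h
    have h1 : (⌈n * x⌉ : ℝ) ≤ 0 := by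
      have : ⌈n * x⌉ ≤ 0 := Int.ceil_le.mpr (by simpa using by nlinarith)
      exact_mod_cast this
    rw [abs_of_neg h0, abs_of_nonpos (div_nonpos_of_nonpos_of_nonneg h1 hn'.le), neg_le_neg_iff,
      le_div_iff₀ hn', mul_comm]
    exact Int.le_ceil _

lemma abs_roundToZero_sub_le {n : ℕ} (hn : 0 < n) (x : ℝ) : |roundToZero n x - x| ≤ 1 / n := by
  have hn' : (0 : ℝ) < n := by exact_mod_cast hn
  unfold roundToZero
  split_ifs with h
  · have : (⌊n * x⌋ : ℝ) / n - x = (⌊n * x⌋ - n * x) / n := by field_simp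
    rw [this, abs_div, abs_of_pos hn']
    refine div_le_div_of_nonneg_right ?_ hn'.le
    rw [abs_le]
    constructor <;> linarith [Int.floor_le ((n : ℝ) * x), Int.lt_floor_add_one ((n : ℝ) * x)]
  · have : (⌈n * x⌉ : ℝ) / n - x = (⌈n * x⌉ - n * x) / n := by field_simp
    rw [this, abs_div, abs_of_pos hn']
    refine div_le_div_of_nonneg_right ?_ hn'.le
    rw [abs_le]
    constructor <;> linarith [Int.le_ceil ((n : ℝ) * x), Int.ceil_lt_add_one ((n : ℝ) * x)]

/-- Uniform approximation of a random point of the `ℓ¹`-ball by points with countably many values. -/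
lemma exists_countable_approx {Ω : Type*} {m : MeasurableSpace Ω} {d : ℕ} {Z : Ω → Fin d → ℝ}
    (hZ : Measurable Z) (hZB : ∀ ω, Z ω ∈ l1Ball d) {ε : ℝ} (hε : 0 < ε) :
    ∃ X : Ω → Fin d → ℝ, Measurable X ∧ (∀ ω, X ω ∈ l1Ball d) ∧ (Set.range X).Countable ∧
      ∀ ω, ∑ i, |(X ω - Z ω) i| ≤ ε := by
  obtain ⟨n, hn⟩ := exists_nat_gt ((d : ℝ) / ε)
  have hn0 : 0 < n := by
    have : (0 : ℝ) < n := lt_of_le_of_lt (by positivity) hn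
    exact_mod_cast this
  have hn' : (0 : ℝ) < n := by exact_mod_cast hn0
  refine ⟨fun ω i => roundToZero n (Z ω i), ?_, fun ω => ?_, ?_, fun ω => ?_⟩
  · exact measurable_pi_lambda _ fun i =>
      (measurable_roundToZero n).comp ((measurable_pi_apply i).comp hZ)
  · exact (Finset.sum_le_sum fun i _ => abs_roundToZero_le hn0 _).trans (hZB ω)
  · refine (Set.countable_range fun (z : Fin d → ℤ) (i : Fin d) => (z i : ℝ) / n).mono ?_
    rintro _ ⟨ω, rfl⟩
    choose z hz using fun i => exists_roundToZero_eq n (Z ω i)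
    exact ⟨z, funext hz⟩
  · calc ∑ i, |roundToZero n (Z ω i) - Z ω i| ≤ ∑ _i : Fin d, 1 / (n : ℝ) :=
          Finset.sum_le_sum fun i _ => abs_roundToZero_sub_le hn0 _
      _ = d / n := by simp [div_eq_mul_inv]
      _ ≤ ε := by
          rw [div_lt_iff₀ hε] at hn
          rw [div_le_iff₀ hn']
          linarith

/-! ### Linearized losses -/

lemma measurable_dotProduct {Ω : Type*} {m : MeasurableSpace Ω} {d : ℕ} {a b : Ω → Fin d → ℝ}
    (ha : Measurable a) (hb : Measurable b) : Measurable fun ω => a ω ⬝ᵥ b ω := by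
  unfold dotProduct
  exact Finset.measurable_sum _ fun i _ =>
    ((measurable_pi_apply i).comp ha).mul ((measurable_pi_apply i).comp hb)

lemma measurable_linearized {Ω : Type*} {m : MeasurableSpace Ω} {d : ℕ}
    {g : Ω → (Fin d → ℝ) → (Fin d → ℝ)}
    (hg : Measurable fun p : Ω × (Fin d → ℝ) => g p.1 p.2) {X : Ω → Fin d → ℝ}
    (hX : Measurable X) (u : Fin d → ℝ) : Measurable fun ω => g ω (X ω) ⬝ᵥ (X ω - u) :=
  measurable_dotProduct (hg.comp (measurable_id.prodMk hX)) (hX.sub_const u)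

/-- A finite convex function on `ℝ^d` is continuous, so measurability at each fixed point upgrades
to joint measurability. -/
lemma measurable_loss_comp {Ω : Type*} {m : MeasurableSpace Ω} {d : ℕ}
    {f : Ω → (Fin d → ℝ) → ℝ} (hconv : ∀ ω, ConvexOn ℝ Set.univ (f ω))
    (hf : ∀ v, Measurable fun ω => f ω v) {X : Ω → Fin d → ℝ} (hX : Measurable X) :
    Measurable fun ω => f ω (X ω) := by
  have h := measurable_uncurry_of_continuous_of_measurable (u := fun v ω => f ω v)
    (fun ω => (hconv ω).locallyLipschitz.continuous) hf
  exact h.comp (hX.prodMk measurable_id)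

lemma abs_loss_sub_le {d : ℕ} {f : (Fin d → ℝ) → ℝ} {g g' v v' : Fin d → ℝ} {G : ℝ}
    (hg : IsSubgradientAt f g v) (hg' : IsSubgradientAt f g' v') (hG : ‖g‖ ≤ G) (hG' : ‖g'‖ ≤ G) :
    |f v' - f v| ≤ G * ∑ i, |(v' - v) i| := by
  have hnn : 0 ≤ ∑ i, |(v' - v) i| := Finset.sum_nonneg fun i _ => abs_nonneg _
  have h1 := hg v'
  have h2 := hg' v
  have h3 := (abs_dotProduct_le_norm_mul_sum g (v' - v)).trans (mul_le_mul_of_nonneg_right hG hnn)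
  have h4 := (abs_dotProduct_le_norm_mul_sum g' (v' - v)).trans
    (mul_le_mul_of_nonneg_right hG' hnn)
  have h5 : g' ⬝ᵥ (v - v') = -(g' ⬝ᵥ (v' - v)) := by
    rw [← dotProduct_neg, neg_sub]
  rw [h5] at h2
  rw [abs_le] at *
  constructor <;> linarith

/-- Moving a point slightly towards `u` does not increase the linearized loss with respect to `u`
by much, although subgradients may be discontinuous. -/
lemma linearized_le_of_near {d : ℕ} {f : (Fin d → ℝ) → ℝ} {g g' v v' u : Fin d → ℝ} {G ε : ℝ}
    (hv : v ∈ l1Ball d) (hu : u ∈ l1Ball d)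
    (hg : IsSubgradientAt f g v) (hg' : IsSubgradientAt f g' v') (hG : ‖g‖ ≤ G) (hG' : ‖g'‖ ≤ G)
    (hε : 0 < ε) (hε1 : ε ≤ 1) (hnear : ∑ i, |(v' - ((1 - ε) • v + ε • u)) i| ≤ ε ^ 2) :
    g' ⬝ᵥ (v' - u) ≤ g ⬝ᵥ (v - u) + 5 * G * ε ∧ |f v' - f v| ≤ 3 * G * ε := by
  have hG0 : 0 ≤ G := (norm_nonneg g).trans hG
  set e := v' - ((1 - ε) • v + ε • u) with he
  have hdiff : v' - v = e - ε • (v - u) := by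
    rw [he]; ext i; simp; ring
  have hdist : ∑ i, |(v' - v) i| ≤ 3 * ε := by
    rw [hdiff]
    calc ∑ i, |(e - ε • (v - u)) i| ≤ ∑ i, (|e i| + ε * |(v - u) i|) := by
          refine Finset.sum_le_sum fun i _ => ?_
          refine (abs_sub _ _).trans ?_
          simp only [Pi.smul_apply, smul_eq_mul, abs_mul, abs_of_pos hε, le_refl]
      _ = ∑ i, |e i| + ε * ∑ i, |(v - u) i| := by rw [Finset.sum_add_distrib, Finset.mul_sum]
      _ ≤ 3 * ε := by nlinarith [sum_abs_sub_le_two hv hu]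
  have hloss : |f v' - f v| ≤ 3 * G * ε := by
    refine (abs_loss_sub_le hg hg' hG hG').trans ?_
    nlinarith
  refine ⟨?_, hloss⟩
  -- Monotonicity of the subdifferential replaces the missing continuity of the subgradients.
  have hmono : 0 ≤ (g' - g) ⬝ᵥ (v' - v) := by
    have h1 := hg v'
    have h2 := hg' v
    have h5 : g' ⬝ᵥ (v - v') = -(g' ⬝ᵥ (v' - v)) := by rw [← dotProduct_neg, neg_sub]
    rw [sub_dotProduct]
    linarith
  have hee : (g' - g) ⬝ᵥ e ≤ 2 * G * ε ^ 2 := by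
    refine (le_abs_self _).trans ((abs_dotProduct_le_norm_mul_sum _ _).trans ?_)
    refine mul_le_mul ?_ hnear (Finset.sum_nonneg fun i _ => abs_nonneg _) (by linarith)
    exact (norm_sub_le _ _).trans (by linarith)
  -- Up to the error `e`, the displacement is `-ε • (v - u)`, so monotonicity bounds `ε` times this
  -- quantity. The error must be of order `ε ^ 2` to remain of order `ε` after division.
  have hv1 : (g' - g) ⬝ᵥ (v - u) ≤ 2 * G * ε := by
    rw [hdiff, dotProduct_sub, dotProduct_smul, smul_eq_mul] at hmono
    have : ε * ((g' - g) ⬝ᵥ (v - u)) ≤ ε * (2 * G * ε) := by nlinarith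
    exact le_of_mul_le_mul_left this hε
  have hv2 : g' ⬝ᵥ (v' - v) ≤ 3 * G * ε := by
    refine (le_abs_self _).trans ((abs_dotProduct_le_norm_mul_sum _ _).trans ?_)
    have := Finset.sum_nonneg fun i (_ : i ∈ Finset.univ) => abs_nonneg ((v' - v) i)
    nlinarith [mul_le_mul hG' hdist this hG0]
  have hsplit : g' ⬝ᵥ (v' - u) = g' ⬝ᵥ (v' - v) + ((g' - g) ⬝ᵥ (v - u) + g ⬝ᵥ (v - u)) := by
    rw [sub_dotProduct]
    have : v' - u = (v' - v) + (v - u) := by abel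
    rw [this, dotProduct_add]
    ring
  linarith

/-- The pointwise comparison behind the second moment bound at a random point. -/
lemma sq_sub_le_of_near {d : ℕ} {f : (Fin d → ℝ) → ℝ} {g g' v v' u : Fin d → ℝ} {G ε κ : ℝ}
    (hv : v ∈ l1Ball d) (hv' : v' ∈ l1Ball d) (hu : u ∈ l1Ball d)
    (hg : IsSubgradientAt f g v) (hg' : IsSubgradientAt f g' v') (hG : ‖g‖ ≤ G) (hG' : ‖g'‖ ≤ G)
    (hκ : 0 ≤ κ) (hε : 0 < ε) (hε1 : ε ≤ 1)
    (hnear : ∑ i, |(v' - ((1 - ε) • v + ε • u)) i| ≤ ε ^ 2) :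
    (g ⬝ᵥ (v - u)) ^ 2 - (κ + 4 * G) * (g ⬝ᵥ (v - u) - (f v - f u)) ≤
      (g' ⬝ᵥ (v' - u)) ^ 2 - κ * (g' ⬝ᵥ (v' - u) - (f v' - f u)) +
        (52 * G ^ 2 + 8 * κ * G) * ε := by
  have hG0 : 0 ≤ G := (norm_nonneg g).trans hG
  obtain ⟨h1, h2⟩ := linearized_le_of_near hv hu hg hg' hG hG' hε hε1 hnear
  have hq := abs_le.mp (abs_dotProduct_sub_le hG hv hu)
  have hq' := abs_le.mp (abs_dotProduct_sub_le hG' hv' hu)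
  have hs' : f v' - f u ≤ g' ⬝ᵥ (v' - u) := by
    have h := hg' u
    have h5 : g' ⬝ᵥ (u - v') = -(g' ⬝ᵥ (v' - u)) := by rw [← dotProduct_neg, neg_sub]
    rw [h5] at h
    linarith
  have h2' := abs_le.mp h2
  set q := g ⬝ᵥ (v - u)
  set q' := g' ⬝ᵥ (v' - u)
  -- Only a lower bound on `q - q'` is available, so `(q - q') (q + q')` is bounded with `q + q' ≤ 4
  -- G` after shifting the first factor to be nonnegative. The term `4 G (q - q')` is then charged
  -- to the convexity gap, through `q' ≥ f v' - f u`.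
  have hsq : q ^ 2 - q' ^ 2 ≤ 4 * G * (q - q') + 40 * G ^ 2 * ε := by
    have ha : (q - q' + 5 * G * ε) * (q + q') ≤ (q - q' + 5 * G * ε) * (4 * G) :=
      mul_le_mul_of_nonneg_left (by linarith) (by linarith)
    have hb : 0 ≤ 5 * G * ε * (4 * G + (q + q')) :=
      mul_nonneg (by positivity) (by linarith)
    nlinarith
  have hc : κ * ((q' - (f v' - f u)) - (q - (f v - f u))) ≤ κ * (8 * G * ε) :=
    mul_le_mul_of_nonneg_left (by linarith) hκ
  have hd : 4 * G * ((f v - f u) - q') ≤ 4 * G * (3 * G * ε) :=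
    mul_le_mul_of_nonneg_left (by linarith) (by linarith)
  nlinarith

/-! ### One round: conditional moments of the linearized regret -/

section OneRound

variable {Ω : Type*} {m mΩ : MeasurableSpace Ω} {μ : Measure Ω} {d : ℕ}
  {f : Ω → (Fin d → ℝ) → ℝ} {g : Ω → (Fin d → ℝ) → (Fin d → ℝ)} {G α β c : ℝ}
  {u v : Fin d → ℝ} {X : Ω → Fin d → ℝ}

lemma integrable_of_abs_le [IsFiniteMeasure μ] {h : Ω → ℝ} (hm : Measurable h) (C : ℝ)
    (hC : ∀ᵐ ω ∂μ, |h ω| ≤ C) : Integrable h μ :=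
  Integrable.of_bound hm.aestronglyMeasurable C hC

lemma ae_abs_linearized_le (hG : ∀ᵐ ω ∂μ, ∀ w ∈ l1Ball d, ‖g ω w‖ ≤ G)
    (hX : ∀ ω, X ω ∈ l1Ball d) (hu : u ∈ l1Ball d) :
    ∀ᵐ ω ∂μ, |g ω (X ω) ⬝ᵥ (X ω - u)| ≤ 2 * G := by
  filter_upwards [hG] with ω h
  exact abs_dotProduct_sub_le (h _ (hX ω)) (hX ω) hu

lemma integrable_linearized [IsFiniteMeasure μ]
    (hg : Measurable fun p : Ω × (Fin d → ℝ) => g p.1 p.2)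
    (hG : ∀ᵐ ω ∂μ, ∀ w ∈ l1Ball d, ‖g ω w‖ ≤ G)
    (hXm : Measurable X) (hX : ∀ ω, X ω ∈ l1Ball d) (hu : u ∈ l1Ball d) :
    Integrable (fun ω => g ω (X ω) ⬝ᵥ (X ω - u)) μ :=
  integrable_of_abs_le (measurable_linearized hg hXm u) _ (ae_abs_linearized_le hG hX hu)

lemma ae_sq_linearized_le (hG : ∀ᵐ ω ∂μ, ∀ w ∈ l1Ball d, ‖g ω w‖ ≤ G)
    (hX : ∀ ω, X ω ∈ l1Ball d) (hu : u ∈ l1Ball d) :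
    ∀ᵐ ω ∂μ, (g ω (X ω) ⬝ᵥ (X ω - u)) ^ 2 ≤ 4 * G ^ 2 := by
  filter_upwards [ae_abs_linearized_le hG hX hu] with ω h
  have := abs_le.mp h
  nlinarith

lemma integrable_sq_linearized [IsFiniteMeasure μ]
    (hg : Measurable fun p : Ω × (Fin d → ℝ) => g p.1 p.2)
    (hG : ∀ᵐ ω ∂μ, ∀ w ∈ l1Ball d, ‖g ω w‖ ≤ G)
    (hXm : Measurable X) (hX : ∀ ω, X ω ∈ l1Ball d) (hu : u ∈ l1Ball d) :
    Integrable (fun ω => (g ω (X ω) ⬝ᵥ (X ω - u)) ^ 2) μ := by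
  refine integrable_of_abs_le ((measurable_linearized hg hXm u).pow_const 2) (4 * G ^ 2) ?_
  filter_upwards [ae_sq_linearized_le hG hX hu] with ω h
  rwa [abs_of_nonneg (sq_nonneg _)]

/-- The loss at the random point differs from the integrable loss at `0` by at most `2 G`. -/
lemma integrable_loss_comp [IsFiniteMeasure μ] (hconv : ∀ ω, ConvexOn ℝ Set.univ (f ω))
    (hsub : ∀ ω, ∀ w ∈ l1Ball d, IsSubgradientAt (f ω) (g ω w) w)
    (hf : ∀ w, Measurable fun ω => f ω w) (hint : ∀ w ∈ l1Ball d, Integrable (fun ω => f ω w) μ)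
    (hG : ∀ᵐ ω ∂μ, ∀ w ∈ l1Ball d, ‖g ω w‖ ≤ G)
    (hXm : Measurable X) (hX : ∀ ω, X ω ∈ l1Ball d) :
    Integrable (fun ω => f ω (X ω)) μ := by
  have h0 := zero_mem_l1Ball d
  have hd : Integrable (fun ω => f ω (X ω) - f ω 0) μ := by
    refine integrable_of_abs_le ((measurable_loss_comp hconv hf hXm).sub (hf 0)) (G * 2) ?_
    filter_upwards [hG] with ω h
    have hG0 : 0 ≤ G := (norm_nonneg _).trans (h 0 h0)
    refine (abs_loss_sub_le (hsub ω 0 h0) (hsub ω _ (hX ω)) (h 0 h0) (h _ (hX ω))).trans ?_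
    exact mul_le_mul_of_nonneg_left (sum_abs_sub_le_two (hX ω) h0) hG0
  exact (hd.add (hint 0 h0)).congr (ae_of_all _ fun ω => by simp)

lemma measurable_invPow {h : Ω → ℝ} (hh : Measurable h) (β : ℝ) :
    Measurable fun ω => invPow (h ω) β := by
  unfold invPow
  split_ifs
  · exact measurable_const
  · exact hh.pow_const _

lemma invPow_nonneg {y : ℝ} (hy : 0 ≤ y) (β : ℝ) : 0 ≤ invPow y β := by
  unfold invPow
  split_ifs
  · exact le_rfl
  · exact Real.rpow_nonneg hy _

lemma invPow_le_invPow {y y' : ℝ} (hy : 0 ≤ y) (hyy : y ≤ y') (hβ : 0 ≤ β) :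
    invPow y β ≤ invPow y' β := by
  unfold invPow
  split_ifs
  · exact le_rfl
  · exact Real.rpow_le_rpow hy hyy (by positivity)

/-- The second moment bound at a fixed point. -/
lemma condExp_quadratic_nonpos_of_const [IsProbabilityMeasure μ]
    (hg : Measurable fun p : Ω × (Fin d → ℝ) => g p.1 p.2)
    (hint : ∀ w ∈ l1Ball d, Integrable (fun ω => f ω w) μ)
    (hG : ∀ᵐ ω ∂μ, ∀ w ∈ l1Ball d, ‖g ω w‖ ≤ G)
    (hα : 0 < α) (hβ : 0 ≤ β) (hβ1 : β ≤ 1) (hc : 0 < c) (hv : v ∈ l1Ball d) (hu : u ∈ l1Ball d)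
    (h0 : β = 0 → ∀ᵐ ω ∂μ, α * (g ω v ⬝ᵥ (v - u)) ^ 2 ≤ 1)
    (hA : ∀ᵐ ω ∂μ, (μ[fun ω' => f ω' v - f ω' u | m]) ω ≤
        (μ[fun ω' => g ω' v ⬝ᵥ (v - u) | m]) ω -
          (μ[fun ω' => invPow (α * (g ω' v ⬝ᵥ (v - u)) ^ 2) β | m]) ω) :
    ∀ᵐ ω ∂μ, (μ[fun ω' => (g ω' v ⬝ᵥ (v - u)) ^ 2 -
      c ^ (β - 1) / α * (g ω' v ⬝ᵥ (v - u) - (f ω' v - f ω' u)) - c ^ β / α | m]) ω ≤ 0 := by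
  set q : Ω → ℝ := fun ω' => g ω' v ⬝ᵥ (v - u) with hq
  set z : Ω → ℝ := fun ω' => invPow (α * (q ω') ^ 2) β with hz
  set D : Ω → ℝ := fun ω' => f ω' v - f ω' u with hD
  set κ := c ^ (β - 1) / α with hκ
  have hκ0 : 0 ≤ κ := by positivity
  have hqm : Measurable q := measurable_linearized hg measurable_const u
  have hqi : Integrable q μ := integrable_linearized hg hG measurable_const (fun _ => hv) hu
  have hq2 : Integrable (fun ω => q ω ^ 2) μ :=
    integrable_sq_linearized hg hG measurable_const (fun _ => hv) hu
  have hDi : Integrable D μ := (hint v hv).sub (hint u hu)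
  have hzi : Integrable z μ := by
    refine integrable_of_abs_le (measurable_invPow ((hqm.pow_const 2).const_mul α) β)
      (invPow (α * (4 * G ^ 2)) β) ?_
    filter_upwards [ae_sq_linearized_le (X := fun _ => v) hG (fun _ => hv) hu] with ω h
    have hnn : 0 ≤ α * q ω ^ 2 := by positivity
    rw [abs_of_nonneg (invPow_nonneg hnn β)]
    exact invPow_le_invPow hnn (mul_le_mul_of_nonneg_left h hα.le) hβ
  have hFi : Integrable (fun ω => q ω ^ 2 - κ * (q ω - D ω) - c ^ β / α) μ :=
    (hq2.sub ((hqi.sub hDi).const_mul κ)).sub (integrable_const _)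
  have hHi : Integrable (κ • ((z - q) + D)) μ := ((hzi.sub hqi).add hDi).smul κ
  have hle : (fun ω => q ω ^ 2 - κ * (q ω - D ω) - c ^ β / α) ≤ᵐ[μ] κ • ((z - q) + D) := by
    have h1 : ∀ᵐ ω ∂μ, β = 0 → α * q ω ^ 2 ≤ 1 := by
      by_cases hb : β = 0
      · filter_upwards [h0 hb] with ω h _ using h
      · exact ae_of_all _ fun ω h => absurd h hb
    filter_upwards [h1] with ω h
    -- Dividing by `α` trades the second moment for the power that exp-concavity controls, plus a
    -- constant.
    have h2 := le_add_invPow (u := α * q ω ^ 2) (by positivity) hβ hβ1 hc h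
    have h3 : q ω ^ 2 ≤ κ * z ω + c ^ β / α := by
      have : κ * z ω + c ^ β / α = (c ^ (β - 1) * z ω + c ^ β) / α := by rw [hκ]; ring
      rw [this, le_div_iff₀ hα]
      linarith
    simp only [Pi.smul_apply, Pi.add_apply, Pi.sub_apply, smul_eq_mul]
    linarith
  have hmono := condExp_mono (m := m) hFi hHi hle
  filter_upwards [hmono, condExp_smul (μ := μ) κ ((z - q) + D) m,
    condExp_add (hzi.sub hqi) hDi m, condExp_sub hzi hqi m, hA] with ω e1 e2 e3 e4 e5
  refine e1.trans ?_
  simp only [Pi.smul_apply, Pi.add_apply, Pi.sub_apply, smul_eq_mul] at e2 e3 e4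
  rw [e2, e3, e4]
  exact mul_nonpos_of_nonneg_of_nonpos hκ0 (by linarith)

/-- The second moment bound at a random point known before the round. The hypotheses on the losses
hold almost surely for fixed points only, and the subgradients need not be continuous. -/
lemma condExp_quadratic_nonpos [IsProbabilityMeasure μ] (hm : m ≤ mΩ)
    (hconv : ∀ ω, ConvexOn ℝ Set.univ (f ω))
    (hsub : ∀ ω, ∀ w ∈ l1Ball d, IsSubgradientAt (f ω) (g ω w) w)
    (hf : ∀ w, Measurable fun ω => f ω w)
    (hg : Measurable fun p : Ω × (Fin d → ℝ) => g p.1 p.2)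
    (hint : ∀ w ∈ l1Ball d, Integrable (fun ω => f ω w) μ)
    (hG : ∀ᵐ ω ∂μ, ∀ w ∈ l1Ball d, ‖g ω w‖ ≤ G)
    (hα : 0 < α) (hβ : 0 ≤ β) (hβ1 : β ≤ 1) (hc : 0 < c) (hu : u ∈ l1Ball d)
    (hA : ∀ w ∈ l1Ball d, (β = 0 → ∀ᵐ ω ∂μ, α * (g ω w ⬝ᵥ (w - u)) ^ 2 ≤ 1) ∧
      ∀ᵐ ω ∂μ, (μ[fun ω' => f ω' w - f ω' u | m]) ω ≤
        (μ[fun ω' => g ω' w ⬝ᵥ (w - u) | m]) ω -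
          (μ[fun ω' => invPow (α * (g ω' w ⬝ᵥ (w - u)) ^ 2) β | m]) ω)
    (hXm : Measurable[m] X) (hX : ∀ ω, X ω ∈ l1Ball d) :
    ∀ᵐ ω ∂μ, (μ[fun ω' => (g ω' (X ω') ⬝ᵥ (X ω' - u)) ^ 2 -
      (c ^ (β - 1) / α + 4 * G) * (g ω' (X ω') ⬝ᵥ (X ω' - u) - (f ω' (X ω') - f ω' u)) -
        c ^ β / α | m]) ω ≤ 0 := by
  set κ := c ^ (β - 1) / α with hκ
  have hκ0 : 0 ≤ κ := by positivity
  set C := 52 * G ^ 2 + 8 * κ * G with hC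
  have hquad : ∀ (b : ℝ) (Y : Ω → Fin d → ℝ), Measurable Y → (∀ ω, Y ω ∈ l1Ball d) →
      Integrable (fun ω' => (g ω' (Y ω') ⬝ᵥ (Y ω' - u)) ^ 2 -
        b * (g ω' (Y ω') ⬝ᵥ (Y ω' - u) - (f ω' (Y ω') - f ω' u)) - c ^ β / α) μ :=
    fun b Y hYm hY =>
      ((integrable_sq_linearized hg hG hYm hY hu).sub
        (((integrable_linearized hg hG hYm hY hu).sub
          ((integrable_loss_comp hconv hsub hf hint hG hYm hY).sub (hint u hu))).const_mul b)).sub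
        (integrable_const _)
  have happrox : ∀ n : ℕ, ∀ᵐ ω ∂μ, (μ[fun ω' => (g ω' (X ω') ⬝ᵥ (X ω' - u)) ^ 2 -
      (κ + 4 * G) * (g ω' (X ω') ⬝ᵥ (X ω' - u) - (f ω' (X ω') - f ω' u)) -
        c ^ β / α | m]) ω ≤ C * (1 / ((n : ℝ) + 1)) := by
    intro n
    set ε : ℝ := 1 / ((n : ℝ) + 1) with hε
    have hε0 : 0 < ε := by positivity
    have hε1 : ε ≤ 1 := by
      rw [hε, div_le_one (by positivity)]
      linarith [n.cast_nonneg (α := ℝ)]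
    have hZm : Measurable[m] fun ω => (1 - ε) • X ω + ε • u :=
      (hXm.const_smul (1 - ε)).add_const _
    have hZ : ∀ ω, (1 - ε) • X ω + ε • u ∈ l1Ball d := fun ω =>
      convex_l1Ball d (hX ω) hu (by linarith) hε0.le (by ring)
    obtain ⟨Y, hYm, hY, hYc, hYn⟩ := exists_countable_approx hZm hZ (pow_pos hε0 2)
    have hYm' : Measurable Y := hYm.mono hm le_rfl
    have hneg := condExp_comp_nonpos (μ := μ) (X := Y)
      (F := fun ω' w => (g ω' w ⬝ᵥ (w - u)) ^ 2 -
        κ * (g ω' w ⬝ᵥ (w - u) - (f ω' w - f ω' u)) - c ^ β / α) hYm hYc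
      (hquad κ Y hYm' hY)
      (by rintro _ ⟨ω, rfl⟩; exact hquad κ (fun _ => Y ω) measurable_const fun _ => hY ω)
      (by
        rintro _ ⟨ω, rfl⟩
        exact condExp_quadratic_nonpos_of_const hg hint hG hα hβ hβ1 hc (hY ω) hu
          (hA _ (hY ω)).1 (hA _ (hY ω)).2)
    have hle : (fun ω' => (g ω' (X ω') ⬝ᵥ (X ω' - u)) ^ 2 -
        (κ + 4 * G) * (g ω' (X ω') ⬝ᵥ (X ω' - u) - (f ω' (X ω') - f ω' u)) - c ^ β / α) ≤ᵐ[μ]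
        ((fun ω' => (g ω' (Y ω') ⬝ᵥ (Y ω' - u)) ^ 2 -
          κ * (g ω' (Y ω') ⬝ᵥ (Y ω' - u) - (f ω' (Y ω') - f ω' u)) - c ^ β / α) +
            fun _ => C * ε) := by
      filter_upwards [hG] with ω h
      have := sq_sub_le_of_near (hX ω) (hY ω) hu (hsub ω _ (hX ω)) (hsub ω _ (hY ω))
        (h _ (hX ω)) (h _ (hY ω)) hκ0 hε0 hε1 (hYn ω)
      simp only [Pi.add_apply]
      linarith
    have hXi := hquad (κ + 4 * G) X (hXm.mono hm le_rfl) hX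
    have hYi := hquad κ Y hYm' hY
    have hmono := condExp_mono (m := m) hXi (hYi.add (integrable_const (C * ε))) hle
    filter_upwards [hmono, condExp_add hYi (integrable_const (C * ε)) m, hneg] with ω e1 e2 e3
    refine e1.trans ?_
    rw [e2, Pi.add_apply, condExp_const hm]
    linarith
  filter_upwards [ae_all_iff.mpr happrox] with ω h
  refine ge_of_tendsto' (x := Filter.atTop) (f := fun n : ℕ => C * (1 / ((n : ℝ) + 1))) ?_ h
  simpa using tendsto_one_div_add_atTop_nhds_zero_nat.const_mul C

/-- Everything the regret analysis needs about the conditional moments of a round. -/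
lemma condExp_round_bounds [IsProbabilityMeasure μ] (hm : m ≤ mΩ)
    (hconv : ∀ ω, ConvexOn ℝ Set.univ (f ω))
    (hsub : ∀ ω, ∀ w ∈ l1Ball d, IsSubgradientAt (f ω) (g ω w) w)
    (hf : ∀ w, Measurable fun ω => f ω w)
    (hg : Measurable fun p : Ω × (Fin d → ℝ) => g p.1 p.2)
    (hint : ∀ w ∈ l1Ball d, Integrable (fun ω => f ω w) μ)
    (hG : ∀ᵐ ω ∂μ, ∀ w ∈ l1Ball d, ‖g ω w‖ ≤ G)
    (hα : 0 < α) (hβ : 0 ≤ β) (hβ1 : β ≤ 1) (hu : u ∈ l1Ball d)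
    (hA : ∀ w ∈ l1Ball d, (β = 0 → ∀ᵐ ω ∂μ, α * (g ω w ⬝ᵥ (w - u)) ^ 2 ≤ 1) ∧
      ∀ᵐ ω ∂μ, (μ[fun ω' => f ω' w - f ω' u | m]) ω ≤
        (μ[fun ω' => g ω' w ⬝ᵥ (w - u) | m]) ω -
          (μ[fun ω' => invPow (α * (g ω' w ⬝ᵥ (w - u)) ^ 2) β | m]) ω)
    (hXm : Measurable[m] X) (hX : ∀ ω, X ω ∈ l1Ball d) :
    ∀ᵐ ω ∂μ,
      (∀ c : ℚ, 0 < c → (μ[fun ω' => (g ω' (X ω') ⬝ᵥ (X ω' - u)) ^ 2 | m]) ω ≤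
        ((c : ℝ) ^ (β - 1) / α + 4 * G) * ((μ[fun ω' => g ω' (X ω') ⬝ᵥ (X ω' - u) | m]) ω -
          ((μ[fun ω' => f ω' (X ω') | m]) ω - (μ[fun ω' => f ω' u | m]) ω)) +
            (c : ℝ) ^ β / α) ∧
      (μ[fun ω' => f ω' (X ω') | m]) ω - (μ[fun ω' => f ω' u | m]) ω ≤
        (μ[fun ω' => g ω' (X ω') ⬝ᵥ (X ω' - u) | m]) ω ∧
      (μ[fun ω' => g ω' (X ω') ⬝ᵥ (X ω' - u) | m]) ω ≤ 2 * G ∧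
      (μ[fun ω' => (g ω' (X ω') ⬝ᵥ (X ω' - u)) ^ 2 | m]) ω ≤ 4 * G ^ 2 := by
  have hXm' : Measurable X := hXm.mono hm le_rfl
  have hq := integrable_linearized hg hG hXm' hX hu
  have hq2 := integrable_sq_linearized hg hG hXm' hX hu
  have hfX := integrable_loss_comp hconv hsub hf hint hG hXm' hX
  have hfu := hint u hu
  have hD := condExp_sub hfX hfu m
  -- The eventual `c` depends on `π`, so one null set must serve all values; restricting to
  -- rationals makes this a countable intersection.
  have h1 : ∀ᵐ ω ∂μ, ∀ c : ℚ, 0 < c →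
      (μ[fun ω' => (g ω' (X ω') ⬝ᵥ (X ω' - u)) ^ 2 | m]) ω ≤
        ((c : ℝ) ^ (β - 1) / α + 4 * G) * ((μ[fun ω' => g ω' (X ω') ⬝ᵥ (X ω' - u) | m]) ω -
          ((μ[fun ω' => f ω' (X ω') | m]) ω - (μ[fun ω' => f ω' u | m]) ω)) +
            (c : ℝ) ^ β / α := by
    rw [ae_all_iff]
    intro c
    by_cases hc : 0 < c
    swap
    · exact ae_of_all _ fun ω h => absurd h hc
    have hc' : (0 : ℝ) < c := by exact_mod_cast hc
    set b := (c : ℝ) ^ (β - 1) / α + 4 * G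
    have hmain := condExp_quadratic_nonpos hm hconv hsub hf hg hint hG hα hβ hβ1 hc' hu hA hXm hX
    have hs := hq.sub (hfX.sub hfu)
    filter_upwards [hmain, condExp_sub (hq2.sub (hs.smul b)) (integrable_const ((c : ℝ) ^ β / α)) m,
      condExp_sub hq2 (hs.smul b) m, condExp_smul (μ := μ) b ((fun ω' => g ω' (X ω') ⬝ᵥ (X ω' - u)) -
        ((fun ω' => f ω' (X ω')) - fun ω' => f ω' u)) m, condExp_sub hq (hfX.sub hfu) m,
      hD] with ω e1 e2 e3 e4 e5 e6 _
    rw [Pi.sub_apply, condExp_const hm] at e2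
    rw [Pi.sub_apply] at e3 e5 e6
    rw [Pi.smul_apply, smul_eq_mul] at e4
    rw [e3, e4, e5, e6] at e2
    have e7 := e2.symm.trans_le e1
    linarith
  have h2 := condExp_mono (m := m) (hfX.sub hfu) hq (ae_of_all _ fun ω => by
    have h := hsub ω _ (hX ω) u
    have h5 : g ω (X ω) ⬝ᵥ (u - X ω) = -(g ω (X ω) ⬝ᵥ (X ω - u)) := by
      rw [← dotProduct_neg, neg_sub]
    rw [h5] at h
    simp only [Pi.sub_apply]
    linarith)
  have h3 := condExp_mono (m := m) hq (integrable_const (2 * G)) (by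
    filter_upwards [ae_abs_linearized_le hG hX hu] with ω h using (abs_le.mp h).2)
  have h4 := condExp_mono (m := m) hq2 (integrable_const (4 * G ^ 2))
    (ae_sq_linearized_le hG hX hu)
  rw [condExp_const hm] at h3 h4
  filter_upwards [h1, h2, h3, h4, hD] with ω e1 e2 e3 e4 e5
  rw [e5, Pi.sub_apply] at e2
  exact ⟨e1, e2, e3, e4⟩

/-- Take conditional expectations in `exp_neg_add_sq_le`, then use `1 + z ≤ exp z`. -/
lemma condExp_exp_le [IsProbabilityMeasure μ] (hm : m ≤ mΩ) {y : Ω → ℝ} (hy : Measurable y)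
    (hbd : ∀ᵐ ω ∂μ, |y ω| ≤ 0.56) :
    ∀ᵐ ω ∂μ, (μ[fun ω' => Real.exp (-y ω' + y ω' ^ 2) | m]) ω ≤
      Real.exp (-(μ[y | m]) ω + 4 * (μ[fun ω' => y ω' ^ 2 | m]) ω) := by
  have hyi : Integrable y μ := integrable_of_abs_le hy _ hbd
  have hsq : ∀ᵐ ω ∂μ, y ω ^ 2 ≤ 1 := by
    filter_upwards [hbd] with ω h
    have := abs_le.mp h
    nlinarith
  have hyi2 : Integrable (fun ω => y ω ^ 2) μ := by
    refine integrable_of_abs_le (hy.pow_const 2) 1 ?_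
    filter_upwards [hsq] with ω h
    rwa [abs_of_nonneg (sq_nonneg _)]
  have hexp : Integrable (fun ω => Real.exp (-y ω + y ω ^ 2)) μ := by
    refine integrable_of_abs_le (Real.measurable_exp.comp (hy.neg.add (hy.pow_const 2)))
      (Real.exp 2) ?_
    filter_upwards [hbd, hsq] with ω h h'
    rw [Real.abs_exp, Real.exp_le_exp]
    have := abs_le.mp h
    linarith
  have hle : (fun ω => Real.exp (-y ω + y ω ^ 2)) ≤ᵐ[μ]
      ((fun _ => (1 : ℝ)) - y) + (4 : ℝ) • fun ω => y ω ^ 2 := by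
    filter_upwards [hbd] with ω h
    exact exp_neg_add_sq_le h
  have h1i : Integrable ((fun _ => (1 : ℝ)) - y) μ := (integrable_const 1).sub hyi
  have hmono := condExp_mono (m := m) hexp (h1i.add (hyi2.smul (4 : ℝ))) hle
  filter_upwards [hmono, condExp_add h1i (hyi2.smul (4 : ℝ)) m,
    condExp_sub (integrable_const (1 : ℝ)) hyi m,
    condExp_smul (μ := μ) (4 : ℝ) (fun ω => y ω ^ 2) m] with ω e1 e2 e3 e4
  refine e1.trans ?_
  rw [e2, Pi.add_apply, e3, e4, Pi.sub_apply, Pi.smul_apply, condExp_const hm, smul_eq_mul]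
  have := Real.add_one_le_exp (-(μ[y | m]) ω + 4 * (μ[fun ω' => y ω' ^ 2 | m]) ω)
  linarith

end OneRound

/-! ### The run of the algorithm as a stochastic process -/

lemma measurable_boaPredict {Ω : Type*} {m : MeasurableSpace Ω} {d K : ℕ} (E : ℝ) (T : ℕ)
    (prior : Fin K → ℝ) (θ : Fin K → Fin d → ℝ) {L : Ω → ℝ → Fin K → ℝ}
    (hL : ∀ η k, Measurable fun ω => L ω η k) :
    Measurable fun ω => boaPredict E T prior θ (L ω) := by
  have hexp : ∀ η k, Measurable fun ω => Real.exp (η * L ω η k) := fun η k =>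
    Real.measurable_exp.comp ((hL η k).const_mul η)
  unfold boaPredict boaWeight
  refine Finset.measurable_sum _ fun k _ => Measurable.smul_const (Measurable.div ?_ ?_) _
  · exact Finset.measurable_sum _ fun i _ => ((hexp _ k).const_mul _).mul_const _
  · exact Finset.measurable_sum _ fun i _ => Finset.measurable_sum _ fun j _ =>
      ((hexp _ j).const_mul _).const_mul _

section Run

variable {Ω : Type*} {mΩ : MeasurableSpace Ω} {μ : Measure Ω} {ℱ : Filtration ℕ mΩ} {d K : ℕ}
  {grad : ℕ → Ω → (Fin d → ℝ) → (Fin d → ℝ)} {E : ℝ} {T : ℕ} {prior : Fin K → ℝ}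
  {θ : Fin K → Fin d → ℝ}

lemma measurable_boaCum
    (hgrad : ∀ t, 1 ≤ t → Measurable[(ℱ t).prod MeasurableSpace.pi]
      (fun p : Ω × (Fin d → ℝ) => grad t p.1 p.2)) (t : ℕ) (η : ℝ) (k : Fin K) :
    Measurable[ℱ t] fun ω => boaCum E T prior θ (fun s => grad s ω) t η k := by
  induction t generalizing η k with
  | zero => exact measurable_const
  | succ t ih =>
    have hmono : ℱ t ≤ ℱ (t + 1) := ℱ.mono (Nat.le_succ t)
    have ih' : ∀ η k, Measurable[ℱ (t + 1)] fun ω =>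
        boaCum E T prior θ (fun s => grad s ω) t η k := fun η k => (ih η k).mono hmono le_rfl
    have hp : Measurable[ℱ (t + 1)] fun ω => boaPredict E T prior θ
        (boaCum E T prior θ (fun s => grad s ω) t) := measurable_boaPredict E T prior θ ih'
    have hr := measurable_linearized (hgrad (t + 1) (by omega)) hp (θ k)
    exact (ih' η k).add (hr.sub ((hr.pow_const 2).const_mul η))

/-- Predictability: the point used in round `t` is the iterate `t - 1`, known before that round. -/
lemma measurable_boaIterate
    (hgrad : ∀ t, 1 ≤ t → Measurable[(ℱ t).prod MeasurableSpace.pi]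
      (fun p : Ω × (Fin d → ℝ) => grad t p.1 p.2)) (t : ℕ) :
    Measurable[ℱ t] fun ω => boaIterate E T prior θ (fun s => grad s ω) t :=
  measurable_boaPredict E T prior θ fun η k => measurable_boaCum hgrad t η k

end Run

/-! ### An exponential supermartingale -/

section Supermartingale

variable {Ω : Type*} {mΩ : MeasurableSpace Ω} {μ : Measure Ω}

/-- The compensated exponential process of `y`. -/
noncomputable def expProcess (μ : Measure Ω) (ℱ : Filtration ℕ mΩ) (y : ℕ → Ω → ℝ) (n : ℕ)
    (ω : Ω) : ℝ :=
  Real.exp (∑ t ∈ Finset.Icc 1 n, ((μ[y t | ℱ (t - 1)]) ω -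
    4 * (μ[fun ω' => y t ω' ^ 2 | ℱ (t - 1)]) ω + (-y t ω + y t ω ^ 2)))

lemma measurable_expProcess {ℱ : Filtration ℕ mΩ} {y : ℕ → Ω → ℝ}
    (hy : ∀ t, 1 ≤ t → Measurable[ℱ t] (y t)) (n : ℕ) :
    Measurable[ℱ n] (expProcess μ ℱ y n) := by
  refine Real.measurable_exp.comp (Finset.measurable_sum _ fun t ht => ?_)
  obtain ⟨h1, h2⟩ := Finset.mem_Icc.mp ht
  have hle : ℱ (t - 1) ≤ ℱ n := ℱ.mono (by omega)
  have hyt : Measurable[ℱ n] (y t) := (hy t h1).mono (ℱ.mono h2) le_rfl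
  have hc1 : Measurable[ℱ n] (μ[y t | ℱ (t - 1)]) :=
    stronglyMeasurable_condExp.measurable.mono hle le_rfl
  have hc2 : Measurable[ℱ n] (μ[fun ω' => y t ω' ^ 2 | ℱ (t - 1)]) :=
    stronglyMeasurable_condExp.measurable.mono hle le_rfl
  exact (hc1.sub (hc2.const_mul 4)).add (hyt.neg.add (hyt.pow_const 2))

/-- The process is a supermartingale started at 1: in each step the past and the compensator are
measurable beforehand and pull out, and `condExp_exp_le` says that the compensator outweighs the new
exponential factor. -/
lemma integral_expProcess_le_one [IsProbabilityMeasure μ] {ℱ : Filtration ℕ mΩ}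
    {y : ℕ → Ω → ℝ} (hy : ∀ t, 1 ≤ t → Measurable[ℱ t] (y t))
    (hbd : ∀ t, 1 ≤ t → ∀ᵐ ω ∂μ, |y t ω| ≤ 0.56) (n : ℕ) :
    Integrable (expProcess μ ℱ y n) μ ∧ ∫ ω, expProcess μ ℱ y n ω ∂μ ≤ 1 := by
  have hint : ∀ n, Integrable (expProcess μ ℱ y n) μ ∧
      ∀ t, 1 ≤ t → Integrable (fun ω => expProcess μ ℱ y n ω *
        Real.exp ((μ[y t | ℱ (t - 1)]) ω - 4 * (μ[fun ω' => y t ω' ^ 2 | ℱ (t - 1)]) ω)) μ := by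
    intro n
    have hterm : ∀ t, 1 ≤ t → ∀ᵐ ω ∂μ, (μ[y t | ℱ (t - 1)]) ω -
        4 * (μ[fun ω' => y t ω' ^ 2 | ℱ (t - 1)]) ω ≤ 1 := by
      intro t ht
      have hyt : Measurable (y t) := (hy t ht).mono (ℱ.le t) le_rfl
      have h1 := condExp_mono (m := ℱ (t - 1)) (integrable_of_abs_le hyt _ (hbd t ht))
        (integrable_const (1 : ℝ))
        (by filter_upwards [hbd t ht] with ω h; linarith [(abs_le.mp h).2])
      have h2 := condExp_nonneg (m := ℱ (t - 1)) (μ := μ) (f := fun ω' => y t ω' ^ 2)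
        (ae_of_all _ fun ω => sq_nonneg _)
      rw [condExp_const (ℱ.le _)] at h1
      filter_upwards [h1, h2] with ω e1 e2
      simp only [Pi.zero_apply] at e2
      linarith
    have hW : ∀ᵐ ω ∂μ, expProcess μ ℱ y n ω ≤ Real.exp (∑ t ∈ Finset.Icc 1 n, (3 : ℝ)) := by
      have hall : ∀ᵐ ω ∂μ, ∀ t ∈ Finset.Icc 1 n, (μ[y t | ℱ (t - 1)]) ω -
          4 * (μ[fun ω' => y t ω' ^ 2 | ℱ (t - 1)]) ω ≤ 1 ∧ |y t ω| ≤ 0.56 := by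
        rw [Filter.eventually_all_finset]
        intro t ht
        have h1 := (Finset.mem_Icc.mp ht).1
        filter_upwards [hterm t h1, hbd t h1] with ω e1 e2 using ⟨e1, e2⟩
      filter_upwards [hall] with ω h
      refine Real.exp_le_exp.mpr (Finset.sum_le_sum fun t ht => ?_)
      obtain ⟨e1, e2⟩ := h t ht
      have := abs_le.mp e2
      nlinarith
    have hWm : Measurable (expProcess μ ℱ y n) := (measurable_expProcess hy n).mono (ℱ.le n) le_rfl
    refine ⟨integrable_of_abs_le hWm (Real.exp (∑ t ∈ Finset.Icc 1 n, (3 : ℝ))) ?_,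
      fun t ht => ?_⟩
    · filter_upwards [hW] with ω h
      rwa [abs_of_pos (show 0 < expProcess μ ℱ y n ω from Real.exp_pos _)]
    · have hU : Measurable fun ω => Real.exp ((μ[y t | ℱ (t - 1)]) ω -
          4 * (μ[fun ω' => y t ω' ^ 2 | ℱ (t - 1)]) ω) := by
        refine Real.measurable_exp.comp (Measurable.sub ?_ (Measurable.const_mul ?_ 4))
        · exact stronglyMeasurable_condExp.measurable.mono (ℱ.le _) le_rfl
        · exact stronglyMeasurable_condExp.measurable.mono (ℱ.le _) le_rfl
      refine integrable_of_abs_le (hWm.mul hU)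
        (Real.exp (∑ t ∈ Finset.Icc 1 n, (3 : ℝ)) * Real.exp 1) ?_
      filter_upwards [hW, hterm t ht] with ω e1 e2
      have hpos : 0 < expProcess μ ℱ y n ω := Real.exp_pos _
      rw [abs_of_pos (mul_pos hpos (Real.exp_pos _))]
      exact mul_le_mul e1 (Real.exp_le_exp.mpr e2) (Real.exp_pos _).le (Real.exp_pos _).le
  refine ⟨(hint n).1, ?_⟩
  induction n with
  | zero => simp [expProcess]
  | succ n ih =>
    refine le_trans ?_ ih
    set A : Ω → ℝ := fun ω => expProcess μ ℱ y n ω *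
      Real.exp ((μ[y (n + 1) | ℱ n]) ω - 4 * (μ[fun ω' => y (n + 1) ω' ^ 2 | ℱ n]) ω) with hA
    set H : Ω → ℝ := fun ω => Real.exp (-y (n + 1) ω + y (n + 1) ω ^ 2) with hH
    have hyt : Measurable (y (n + 1)) := (hy _ (by omega)).mono (ℱ.le _) le_rfl
    have hWH : expProcess μ ℱ y (n + 1) = A * H := by
      ext ω
      simp only [expProcess, Pi.mul_apply, hA, hH]
      rw [Finset.sum_Icc_succ_top (by omega), ← Real.exp_add, ← Real.exp_add, Nat.add_sub_cancel]
      congr 1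
      ring
    have hAm : StronglyMeasurable[ℱ n] A := by
      refine Measurable.stronglyMeasurable ((measurable_expProcess hy n).mul
        (Real.measurable_exp.comp (Measurable.sub ?_ (Measurable.const_mul ?_ 4))))
      · exact stronglyMeasurable_condExp.measurable
      · exact stronglyMeasurable_condExp.measurable
    have hHi : Integrable H μ := by
      refine integrable_of_abs_le (Real.measurable_exp.comp (hyt.neg.add (hyt.pow_const 2)))
        (Real.exp 2) ?_
      filter_upwards [hbd (n + 1) (by omega)] with ω h
      rw [Real.abs_exp, Real.exp_le_exp]
      have := abs_le.mp h
      nlinarith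
    have hAHi : Integrable (A * H) μ := hWH ▸ (hint (n + 1)).1
    have hpull := condExp_mul_of_stronglyMeasurable_left hAm hAHi hHi
    have hcond := condExp_exp_le (μ := μ) (ℱ.le n) hyt (hbd (n + 1) (by omega))
    calc ∫ ω, expProcess μ ℱ y (n + 1) ω ∂μ = ∫ ω, (μ[A * H | ℱ n]) ω ∂μ := by
          rw [integral_condExp (ℱ.le n), hWH]
      _ ≤ ∫ ω, expProcess μ ℱ y n ω ∂μ := by
          refine integral_mono_ae integrable_condExp (hint n).1 ?_
          filter_upwards [hpull, hcond] with ω e1 e2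
          rw [e1, Pi.mul_apply]
          have hpos : 0 < expProcess μ ℱ y n ω := Real.exp_pos _
          calc A ω * (μ[H | ℱ n]) ω ≤ A ω * Real.exp (-(μ[y (n + 1) | ℱ n]) ω +
                4 * (μ[fun ω' => y (n + 1) ω' ^ 2 | ℱ n]) ω) :=
              mul_le_mul_of_nonneg_left e2 (mul_pos hpos (Real.exp_pos _)).le
            _ = expProcess μ ℱ y n ω := by
              rw [hA]
              simp only
              rw [mul_assoc, ← Real.exp_add]
              ring_nf
              rw [Real.exp_zero, mul_one]

/-- Markov's inequality for a mixture of nonnegative functions of integral at most one. -/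
lemma measure_mixture_lt {ι : Type*} [IsProbabilityMeasure μ] (s : Finset ι) (w : ι → ℝ)
    (hw : ∀ i ∈ s, 0 ≤ w i) {W : ι → Ω → ℝ} (hWm : ∀ i, Measurable (W i))
    (hWi : ∀ i ∈ s, Integrable (W i) μ ∧ ∫ ω, W i ω ∂μ ≤ 1) (hW0 : ∀ i ω, 0 ≤ W i ω)
    {N : ℝ} (hN : 0 < N) (hwN : ∑ i ∈ s, w i ≤ N) (x : ℝ) :
    MeasurableSet {ω | ∑ i ∈ s, w i * W i ω < N * Real.exp x} ∧
      μ {ω | ∑ i ∈ s, w i * W i ω < N * Real.exp x}ᶜ ≤ ENNReal.ofReal (Real.exp (-x)) := by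
  have hm : Measurable fun ω => ∑ i ∈ s, w i * W i ω :=
    Finset.measurable_sum _ fun i _ => (hWm i).const_mul _
  have hi : Integrable (fun ω => ∑ i ∈ s, w i * W i ω) μ :=
    integrable_finsetSum _ fun i hi => (hWi i hi).1.const_mul _
  refine ⟨measurableSet_lt hm measurable_const, ?_⟩
  have hmarkov := mul_meas_ge_le_integral_of_nonneg (μ := μ)
    (ae_of_all _ fun ω => Finset.sum_nonneg fun i hi => mul_nonneg (hw i hi) (hW0 i ω)) hi
    (N * Real.exp x)
  have hintle : ∫ ω, ∑ i ∈ s, w i * W i ω ∂μ ≤ N := by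
    rw [integral_finsetSum _ fun i hi => (hWi i hi).1.const_mul _]
    refine le_trans (Finset.sum_le_sum fun i hi => ?_) hwN
    rw [integral_const_mul]
    nlinarith [(hWi i hi).2, hw i hi]
  have hcompl : {ω | ∑ i ∈ s, w i * W i ω < N * Real.exp x}ᶜ =
      {ω | N * Real.exp x ≤ ∑ i ∈ s, w i * W i ω} := by
    ext ω; simp
  rw [hcompl, ← ofReal_measureReal]
  refine ENNReal.ofReal_le_ofReal ?_
  have h1 := hmarkov.trans hintle
  rw [Real.exp_neg, ← one_div, le_div_iff₀ (Real.exp_pos _)]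
  have h2 : N * (μ.real {ω | N * Real.exp x ≤ ∑ i ∈ s, w i * W i ω} * Real.exp x) ≤ N * 1 := by
    linarith
  exact le_of_mul_le_mul_left h2 hN

end Supermartingale

/-! ### Tuning -/

lemma learningRate_succ (E : ℝ) (i : ℕ) :
    learningRate E i = Real.exp 1 * learningRate E (i + 1) := by
  unfold learningRate
  have : Real.exp ((i + 1 : ℕ) : ℝ) = Real.exp 1 * Real.exp i := by
    rw [← Real.exp_add]; congr 1; push_cast; ring
  rw [this]
  field_simp

/-- A target learning rate is in the grid up to a factor, unless it is below the whole grid. -/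
lemma exists_learningRate {E ρ : ℝ} {N : ℕ} (hE : 0 < E) (hρE : ρ < E⁻¹)
    (hN : learningRate E N ≤ ρ) :
    ∃ i ∈ Finset.Icc 1 N, learningRate E i ≤ ρ ∧ ρ ≤ 3 * learningRate E i := by
  classical
  have hex : ∃ i, learningRate E i ≤ ρ := ⟨N, hN⟩
  have h0 : Nat.find hex ≠ 0 := by
    intro h
    have := Nat.find_spec hex
    rw [h] at this
    simp [learningRate] at this
    linarith
  obtain ⟨j, hj⟩ := Nat.exists_eq_succ_of_ne_zero h0
  -- The first rate at or below `ρ` has a predecessor above `ρ`, larger only by the factor `e < 3`.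
  -- Index `0` is excluded because its rate is `E⁻¹ > ρ`.
  refine ⟨Nat.find hex, Finset.mem_Icc.mpr ⟨by omega, Nat.find_min' hex hN⟩, Nat.find_spec hex, ?_⟩
  have hlt : ¬ learningRate E j ≤ ρ := Nat.find_min hex (by omega)
  rw [learningRate_succ] at hlt
  rw [hj]
  have he := Real.exp_one_lt_d9
  have := learningRate_pos hE (j + 1)
  push Not at hlt
  change _ ≤ 3 * learningRate E (j + 1)
  nlinarith

/-- Since `16 G² = 9 E²`, the left side is `9 E T / exp ⌊log (E T)⌋`, and the floor loses at most a
factor `e < 3`. At the smallest rate the variance term is therefore bounded by a constant. -/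
lemma learningRate_last_le {G : ℝ} {T : ℕ} (hG : 0 < G) (hT : 1 ≤ T) :
    16 * G ^ 2 * T * learningRate (4 * G / 3) ⌊Real.log (4 * G / 3 * T)⌋₊ ≤ 27 := by
  have hT' : (0 : ℝ) < T := by exact_mod_cast hT
  set E := 4 * G / 3 with hE
  have hE0 : 0 < E := by positivity
  have h1 : E * T ≤ Real.exp 1 * Real.exp ⌊Real.log (E * T)⌋₊ := by
    rw [← Real.exp_add, ← Real.log_le_iff_le_exp (by positivity), add_comm]
    exact (Nat.lt_floor_add_one _).le
  have h2 : E * T ≤ 3 * Real.exp ⌊Real.log (E * T)⌋₊ := by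
    refine h1.trans (mul_le_mul_of_nonneg_right ?_ (Real.exp_pos _).le)
    linarith [Real.exp_one_lt_d9]
  unfold learningRate
  rw [← div_eq_mul_inv, div_le_iff₀ (by positivity)]
  have h3 : 16 * G ^ 2 * T = 9 * (E * T) * E := by rw [hE]; ring
  rw [h3]
  nlinarith [mul_le_mul_of_nonneg_right h2 hE0.le]

/-- The choice of the learning rate in the regret bounds. -/
lemma sub_le_of_tuning {G α β a B Q V S : ℝ} {T : ℕ} (hG : 0 < G) (hα : 0 < α) (hβ : 0 ≤ β)
    (hβ1 : β ≤ 1) (hT : 1 ≤ T) (hgrid : 1 ≤ Real.log (4 * G / 3 * T)) (ha : 0 < a)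
    (hB0 : 0 ≤ B) (hB : B ≤ 6 * a) (hS : 0 ≤ S) (hV : V ≤ 4 * G ^ 2 * T)
    (hQ : ∀ i ∈ rateIndices (4 * G / 3) T, learningRate (4 * G / 3) i * Q ≤
      4 * learningRate (4 * G / 3) i ^ 2 * V + B)
    (hVS : ∀ c : ℚ, 0 < c → V ≤ ((c : ℝ) ^ (β - 1) / α + 4 * G) * S + T * ((c : ℝ) ^ β / α)) :
    Q - S ≤ 300 * (T * (a / (α * T)) ^ (1 / (2 - β)) + G * a + 1) := by
  have hT' : (0 : ℝ) < T := by exact_mod_cast hT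
  have hE0 : 0 < 4 * G / 3 := by positivity
  have hb : 0 < 2 - β := by linarith
  have hbase : 0 < a / (α * T) := by positivity
  set c := (a / (α * T)) ^ (1 / (2 - β)) with hc
  have hc0 : 0 < c := Real.rpow_pos_of_pos hbase _
  have hcpow : c ^ (2 - β) = a / (α * T) := by
    rw [hc, ← Real.rpow_mul hbase.le, one_div, inv_mul_cancel₀ hb.ne', Real.rpow_one]
  set P := c ^ (β - 1) with hP
  have hP0 : 0 < P := Real.rpow_pos_of_pos hc0 _
  have hcβ : c ^ β = P * c := by
    rw [hP, ← Real.rpow_add_one hc0.ne']; congr 1; ring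
  -- The balance defining `c`: the complexity cost `a κ` and the slack `T c` are of the same order.
  have haP : a * P / α = T * c := by
    have h1 : P * c ^ (2 - β) = c := by
      rw [hP, ← Real.rpow_add hc0]
      conv_rhs => rw [← Real.rpow_one c]
      congr 1; ring
    rw [hcpow] at h1
    calc a * P / α = T * (P * (a / (α * T))) := by field_simp
      _ = T * c := by rw [h1]
  -- The factor 2 pays for replacing `c` by a rational in `(c / 2, c)`.
  set κ := 2 * P / α + 4 * G with hκ
  have hκ0 : 0 < κ := by positivity
  have hVc : V ≤ κ * S + T * (P * c / α) := by
    obtain ⟨r, hr1, hr2⟩ := exists_rat_btwn (show c / 2 < c by linarith)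
    have hr0 : (0 : ℝ) < r := by linarith
    have hr0' : 0 < r := by exact_mod_cast hr0
    refine (hVS r hr0').trans ?_
    have h1 : (r : ℝ) ^ (β - 1) ≤ 2 * P := by
      have h2 := Real.rpow_le_rpow_of_nonpos (by linarith : 0 < c / 2) hr1.le
        (by linarith : β - 1 ≤ 0)
      refine h2.trans ?_
      rw [Real.div_rpow hc0.le (by norm_num), div_eq_mul_inv, ← Real.rpow_neg (by norm_num)]
      have h3 : (2 : ℝ) ^ (-(β - 1)) ≤ 2 := by
        conv_rhs => rw [← Real.rpow_one (2 : ℝ)]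
        exact Real.rpow_le_rpow_of_exponent_le (by norm_num) (by linarith)
      nlinarith
    have h4 : (r : ℝ) ^ β ≤ P * c := by
      rw [← hcβ]; exact Real.rpow_le_rpow hr0.le hr2.le hβ
    have h5 : ((r : ℝ) ^ (β - 1) / α + 4 * G) * S ≤ κ * S := by
      refine mul_le_mul_of_nonneg_right ?_ hS
      rw [hκ]
      gcongr
    have h6 : T * ((r : ℝ) ^ β / α) ≤ T * (P * c / α) := by gcongr
    linarith
  -- With `4 ρ κ = 1`, any rate `η ≤ ρ` satisfies `4 η κ S ≤ S`, so the gap absorbs the variance.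
  set ρ := 1 / (4 * κ) with hρ
  have hρ0 : 0 < ρ := by positivity
  have hρκ : 4 * ρ * κ = 1 := by rw [hρ]; field_simp
  have hBκ : B * κ ≤ 12 * (T * c) + 24 * (G * a) := by
    calc B * κ ≤ 6 * a * κ := mul_le_mul_of_nonneg_right hB hκ0.le
      _ = 12 * (a * P / α) + 24 * (G * a) := by rw [hκ]; ring
      _ = _ := by rw [haP]
  have hGa : 0 < G * a := by positivity
  have hTc : 0 < T * c := by positivity
  have hBdiv : ∀ η : ℝ, 0 < η → ρ ≤ 3 * η → B / η ≤ 12 * (B * κ) := by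
    intro η hη h
    rw [div_le_iff₀ hη]
    have h1 : 1 ≤ 12 * κ * η := by
      have := mul_le_mul_of_nonneg_right h hκ0.le
      linarith
    calc B = B * 1 := (mul_one B).symm
      _ ≤ B * (12 * κ * η) := mul_le_mul_of_nonneg_left h1 hB0
      _ = 12 * (B * κ) * η := by ring
  rcases le_or_gt (learningRate (4 * G / 3) ⌊Real.log (4 * G / 3 * T)⌋₊) ρ with hle | hgt
  · have hρE : ρ < (4 * G / 3)⁻¹ := by
      rw [hρ, one_div]
      refine inv_strictAnti₀ hE0 ?_
      have : 0 < 2 * P / α := by positivity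
      rw [hκ]; linarith
    obtain ⟨i, hi, h1, h2⟩ := exists_learningRate hE0 hρE hle
    have hη := learningRate_pos hE0 i
    set η := learningRate (4 * G / 3) i
    have hq : Q ≤ 4 * η * V + B / η := by
      have := hQ i hi
      refine le_of_mul_le_mul_left (this.trans (le_of_eq ?_)) hη
      field_simp
      ring
    have h3 : 4 * η * V ≤ S + T * c := by
      have h4 : 4 * η * V ≤ 4 * η * (κ * S + T * (P * c / α)) :=
        mul_le_mul_of_nonneg_left hVc (by positivity)
      have h5 : 4 * η * (κ * S + T * (P * c / α)) ≤ 4 * ρ * (κ * S + T * (P * c / α)) := by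
        exact mul_le_mul_of_nonneg_right (by linarith) (by positivity)
      have h6 : P / α ≤ κ := by
        have : 0 < P / α := by positivity
        have h7 : 2 * P / α = 2 * (P / α) := by ring
        rw [hκ, h7]; linarith
      have h8 : 4 * ρ * (κ * S + T * (P * c / α)) = (4 * ρ * κ) * S + 4 * ρ * (P / α) * (T * c) := by
        ring
      have h9 : 4 * ρ * (P / α) ≤ 1 := by rw [← hρκ]; gcongr
      rw [h8, hρκ] at h5
      have h10 := mul_le_mul_of_nonneg_right h9 hTc.le
      linarith
    have h4 := hBdiv η hη h2
    linarith
  -- The target lies below the whole grid. The smallest rate is used with the crude bound on `V`;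
  -- its variance cost of at most 27 is the source of the `+ 1` in the bound.
  · have hη := learningRate_pos hE0 ⌊Real.log (4 * G / 3 * T)⌋₊
    have hlast := learningRate_last_le hG hT
    have hmem : ⌊Real.log (4 * G / 3 * T)⌋₊ ∈ rateIndices (4 * G / 3) T :=
      Finset.mem_Icc.mpr ⟨(Nat.one_le_floor_iff _).mpr hgrid, le_rfl⟩
    have hq' := hQ _ hmem
    set η := learningRate (4 * G / 3) ⌊Real.log (4 * G / 3 * T)⌋₊
    have hq : Q ≤ 4 * η * V + B / η := by
      refine le_of_mul_le_mul_left (hq'.trans (le_of_eq ?_)) hη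
      field_simp
    have h3 : 4 * η * V ≤ 27 := by
      have : 4 * η * V ≤ 4 * η * (4 * G ^ 2 * T) := mul_le_mul_of_nonneg_left hV (by positivity)
      linarith
    have h4 := hBdiv η hη (by linarith)
    linarith

lemma log_gt_two_thirds {G : ℝ} {T : ℕ} (hG : 0 < G) (hT : 1 ≤ T)
    (hgrid : 1 ≤ Real.log (4 * G / 3 * T)) :
    2 / 3 ≤ Real.log (G * T) ∧ Real.log (4 * G / 3 * T) ≤ Real.log (G * T) + 1 / 3 := by
  have hT' : (0 : ℝ) < T := by exact_mod_cast hT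
  have h1 : Real.log (4 * G / 3 * T) = Real.log (4 / 3) + Real.log (G * T) := by
    rw [← Real.log_mul (by norm_num) (by positivity)]; congr 1; ring
  have h2 : Real.log (4 / 3 : ℝ) ≤ 1 / 3 := by
    have := Real.log_le_sub_one_of_pos (show (0 : ℝ) < 4 / 3 by norm_num)
    linarith
  constructor <;> linarith

/-- The complexity term dominates the cost of the grid of learning rates. -/
lemma complexity_bounds {G x κ : ℝ} {T : ℕ} (hG : 0 < G) (hT : 1 ≤ T)
    (hgrid : 1 ≤ Real.log (4 * G / 3 * T)) (hx : Real.log 2 ≤ x) (hκ : 0 ≤ κ) :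
    1 / 4 ≤ κ + Real.log (Real.log (G * T)) + x ∧
      2 * (κ + Real.log (rateIndices (4 * G / 3) T).card) + x ≤
        6 * (κ + Real.log (Real.log (G * T)) + x) := by
  obtain ⟨hL, hle⟩ := log_gt_two_thirds hG hT hgrid
  set L := Real.log (G * T)
  have hL0 : 0 < L := by linarith
  -- The iterated logarithm may be negative, but `L ≥ 2 / 3` and `x ≥ log 2` give `log L + x ≥ log
  -- (4 / 3) ≥ 1 / 4`.
  have h1 : 1 / 4 ≤ Real.log L + x := by
    have h2 : Real.log (4 / 3) ≤ Real.log L + Real.log 2 := by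
      rw [← Real.log_mul hL0.ne' (by norm_num)]
      exact Real.log_le_log (by norm_num) (by linarith)
    have h3 := Real.one_sub_inv_le_log_of_pos (show (0 : ℝ) < 4 / 3 by norm_num)
    norm_num at h3
    linarith
  have hN1 : 1 ≤ ⌊Real.log (4 * G / 3 * T)⌋₊ := (Nat.one_le_floor_iff _).mpr hgrid
  have hcard : ((rateIndices (4 * G / 3) T).card : ℝ) ≤ L + 1 / 3 := by
    have : (rateIndices (4 * G / 3) T).card = ⌊Real.log (4 * G / 3 * T)⌋₊ := by
      simp [rateIndices]
    rw [this]
    exact (Nat.floor_le (by linarith)).trans hle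
  have hcard0 : (0 : ℝ) < (rateIndices (4 * G / 3) T).card := by
    have : (rateIndices (4 * G / 3) T).card = ⌊Real.log (4 * G / 3 * T)⌋₊ := by
      simp [rateIndices]
    rw [this]
    exact_mod_cast hN1
  -- This is `L + 1 / 3 ≤ 4 L ^ 3` for `L ≥ 2 / 3`; a power of `L` is needed because `L` may be
  -- below 1, and the leftover `log 2` is charged to `x`.
  have h4 : Real.log (rateIndices (4 * G / 3) T).card ≤ 3 * Real.log L + 2 * Real.log 2 := by
    have h5 : 3 * Real.log L + 2 * Real.log 2 = Real.log (L ^ 3 * 2 ^ 2) := by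
      rw [Real.log_mul (by positivity) (by norm_num), Real.log_pow, Real.log_pow]
      norm_num
    rw [h5]
    refine Real.log_le_log hcard0 (hcard.trans ?_)
    nlinarith [mul_nonneg (sub_nonneg.mpr hL) (sub_nonneg.mpr hL),
      mul_nonneg hL0.le (mul_nonneg (sub_nonneg.mpr hL) (sub_nonneg.mpr hL))]
  have hlog2 := Real.log_pos (show (1 : ℝ) < 2 by norm_num)
  constructor <;> linarith

/-! ### The high probability event -/

/-- On an event of probability at least `1 - exp (-x)`, the conditional linearized regret has a
second-order bound for each learning rate of the grid. -/
lemma exists_event {Ω : Type*} {mΩ : MeasurableSpace Ω} {μ : Measure Ω} [IsProbabilityMeasure μ]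
    {ℱ : Filtration ℕ mΩ} {d K T : ℕ} {ℓ : ℕ → Ω → (Fin d → ℝ) → ℝ}
    {grad : ℕ → Ω → (Fin d → ℝ) → (Fin d → ℝ)} {θ : Fin K → Fin d → ℝ} {prior : Fin K → ℝ} {G : ℝ}
    (hθ : ∀ k, θ k ∈ l1Ball d) (hprior : prior ∈ stdSimplex ℝ (Fin K)) (hG : 0 < G)
    (hgrid : 1 ≤ Real.log (4 * G / 3 * T)) (hloss : IsLossSequence μ ℱ ℓ grad)
    (hlip : LipschitzLoss μ grad G) {P : Ω → Prop} (hP : ∀ᵐ ω ∂μ, P ω) (x : ℝ)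
    {p : ℕ → Ω → Fin d → ℝ}
    (hp : p = fun t ω => boaIterate (4 * G / 3) T prior θ (fun s => grad s ω) t) :
    ∃ S : Set Ω, MeasurableSet S ∧ ENNReal.ofReal (1 - Real.exp (-x)) ≤ μ S ∧ ∀ ω ∈ S, P ω ∧
      ∀ i ∈ rateIndices (4 * G / 3) T, ∀ π ∈ stdSimplex ℝ (Fin K), (∀ k, prior k = 0 → π k = 0) →
        learningRate (4 * G / 3) i * ∑ k, π k * ∑ t ∈ Finset.Icc 1 T,
          (μ[fun ω' => grad t ω' (p (t - 1) ω') ⬝ᵥ (p (t - 1) ω' - θ k) | ℱ (t - 1)]) ω ≤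
        4 * learningRate (4 * G / 3) i ^ 2 * ∑ k, π k * ∑ t ∈ Finset.Icc 1 T,
          (μ[fun ω' => (grad t ω' (p (t - 1) ω') ⬝ᵥ (p (t - 1) ω' - θ k)) ^ 2 | ℱ (t - 1)]) ω +
        (2 * (klFin π prior + Real.log (rateIndices (4 * G / 3) T).card) + x) := by
  have hE : 0 < 4 * G / 3 := by positivity
  set E := 4 * G / 3 with hEdef
  set N := (rateIndices E T).card with hN
  have hN0 : (0 : ℝ) < N := by
    have : 0 < N := Finset.card_pos.mpr
      ⟨1, Finset.mem_Icc.mpr ⟨le_rfl, (Nat.one_le_floor_iff _).mpr hgrid⟩⟩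
    exact_mod_cast this
  have hpB : ∀ t ω, p t ω ∈ l1Ball d := by
    intro t ω
    rw [hp]
    exact boaPredict_mem_l1Ball hE hgrid hprior hθ _
  have hpm : ∀ t, Measurable[ℱ t] (p t) := by
    intro t
    rw [hp]
    exact measurable_boaIterate hloss.measurable_grad t
  set q : Fin K → ℕ → Ω → ℝ := fun k t ω =>
    grad t ω (p (t - 1) ω) ⬝ᵥ (p (t - 1) ω - θ k) with hq
  have hqm : ∀ k t, 1 ≤ t → Measurable[ℱ t] (q k t) := fun k t ht =>
    measurable_linearized (hloss.measurable_grad t ht)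
      ((hpm (t - 1)).mono (ℱ.mono (Nat.sub_le t 1)) le_rfl) (θ k)
  have hqbd : ∀ k t, 1 ≤ t → ∀ᵐ ω ∂μ, |q k t ω| ≤ 2 * G := fun k t ht =>
    ae_abs_linearized_le (hlip t ht) (hpB (t - 1)) (hθ k)
  set y : ℕ × Fin K → ℕ → Ω → ℝ := fun j t => learningRate E j.1 • q j.2 t with hy
  have hym : ∀ j t, 1 ≤ t → Measurable[ℱ t] (y j t) := fun j t ht =>
    (hqm j.2 t ht).const_smul (learningRate E j.1)
  have hybd : ∀ j : ℕ × Fin K, 1 ≤ j.1 → ∀ t, 1 ≤ t → ∀ᵐ ω ∂μ, |y j t ω| ≤ 0.56 := by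
    intro j hj t ht
    filter_upwards [hqbd j.2 t ht] with ω h
    exact abs_learningRate_mul_le hG hj h
  have hsum : ∑ j ∈ rateIndices E T ×ˢ (Finset.univ : Finset (Fin K)), prior j.2 = N := by
    rw [Finset.sum_product]
    simp [hprior.2, hN]
  obtain ⟨hMm, hMμ⟩ := measure_mixture_lt (μ := μ)
    (rateIndices E T ×ˢ (Finset.univ : Finset (Fin K)))
    (fun j => prior j.2) (fun j _ => hprior.1 j.2)
    (W := fun j => expProcess μ ℱ (y j) T)
    (fun j => (measurable_expProcess (hym j) T).mono (ℱ.le T) le_rfl)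
    (fun j hj => integral_expProcess_le_one (hym j)
      (hybd j (Finset.mem_Icc.mp (Finset.mem_product.mp hj).1).1) T)
    (fun j ω => (Real.exp_pos _).le) hN0 hsum.le x
  set M := {ω | ∑ j ∈ rateIndices E T ×ˢ (Finset.univ : Finset (Fin K)),
    prior j.2 * expProcess μ ℱ (y j) T ω < N * Real.exp x} with hM
  have hlin : ∀ᵐ ω ∂μ, ∀ j t, (μ[y j t | ℱ (t - 1)]) ω =
      learningRate E j.1 * (μ[q j.2 t | ℱ (t - 1)]) ω ∧
      (μ[fun ω' => y j t ω' ^ 2 | ℱ (t - 1)]) ω =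
        learningRate E j.1 ^ 2 * (μ[fun ω' => q j.2 t ω' ^ 2 | ℱ (t - 1)]) ω := by
    rw [ae_all_iff]
    intro j
    rw [ae_all_iff]
    intro t
    have h2 : (fun ω' => y j t ω' ^ 2) =
        (learningRate E j.1 ^ 2) • fun ω' => q j.2 t ω' ^ 2 := by
      ext ω
      simp only [hy, Pi.smul_apply, smul_eq_mul]
      ring
    rw [h2]
    filter_upwards [condExp_smul (μ := μ) (learningRate E j.1) (q j.2 t) (ℱ (t - 1)),
      condExp_smul (μ := μ) (learningRate E j.1 ^ 2) (fun ω' => q j.2 t ω' ^ 2) (ℱ (t - 1))]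
      with ω e1 e2
    exact ⟨e1, e2⟩
  have hlip' : ∀ᵐ ω ∂μ, ∀ t, 1 ≤ t → ∀ v ∈ l1Ball d, ‖grad t ω v‖ ≤ G := by
    rw [ae_all_iff]
    intro t
    by_cases ht : 1 ≤ t
    · filter_upwards [hlip t ht] with ω h _ using h
    · exact ae_of_all _ fun ω h => absurd h ht
  -- Removing a measurable null superset of the exceptional set makes all almost sure statements
  -- hold everywhere on a measurable event.
  obtain ⟨A, hAsub, hAm, hA0⟩ := exists_measurable_superset_of_null
    (ae_iff.mp (hP.and (hlin.and hlip')))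
  refine ⟨M \ A, hMm.diff hAm, ?_, ?_⟩
  · rw [measure_sdiff_null hA0]
    have h1 : μ M = 1 - μ Mᶜ := by
      rw [← prob_compl_eq_one_sub hMm.compl, compl_compl]
    rw [h1, ENNReal.ofReal_sub _ (Real.exp_pos _).le, ENNReal.ofReal_one]
    exact tsub_le_tsub_left hMμ 1
  · rintro ω ⟨hωM, hωA⟩
    obtain ⟨hPω, hlinω, hlipω⟩ := not_not.mp fun h => hωA (hAsub h)
    refine ⟨hPω, fun i hi π hπ hac => ?_⟩
    set η := learningRate E i
    have hreg := sum_mul_boaCum_le hG hgrid hprior hθ (fun s => grad s ω) hlipω T hi hπ hac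
    have hle : ∑ k, prior k * expProcess μ ℱ (y (i, k)) T ω ≤ N * Real.exp x := by
      refine le_trans ?_ (le_of_lt hωM)
      rw [Finset.sum_product]
      exact Finset.single_le_sum
        (f := fun i => ∑ k, prior k * expProcess μ ℱ (y (i, k)) T ω)
        (fun i _ => Finset.sum_nonneg fun k _ => mul_nonneg (hprior.1 k) (Real.exp_pos _).le) hi
    have hmart := sum_mul_le_klFin_add_log_of_le hπ hprior hac _ hle
    rw [Real.log_mul hN0.ne' (Real.exp_ne_zero _), Real.log_exp] at hmart
    -- The realized part of the exponent is exactly minus the quantity bounded pathwise by `hreg`,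
    -- so adding the two bounds leaves only conditional moments.
    have hterm : ∀ k, π k * ∑ t ∈ Finset.Icc 1 T, ((μ[y (i, k) t | ℱ (t - 1)]) ω -
        4 * (μ[fun ω' => y (i, k) t ω' ^ 2 | ℱ (t - 1)]) ω +
          (-y (i, k) t ω + y (i, k) t ω ^ 2)) =
        η * (π k * ∑ t ∈ Finset.Icc 1 T, (μ[q k t | ℱ (t - 1)]) ω) -
        4 * η ^ 2 * (π k * ∑ t ∈ Finset.Icc 1 T, (μ[fun ω' => q k t ω' ^ 2 | ℱ (t - 1)]) ω) -
        π k * (η * boaCum E T prior θ (fun s => grad s ω) T η k) := by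
      intro k
      have hcum : boaCum E T prior θ (fun s => grad s ω) T η k =
          ∑ t ∈ Finset.Icc 1 T, (q k t ω - η * q k t ω ^ 2) := by
        rw [boaCum_eq_sum, hq, hp]
      rw [hcum]
      simp only [Finset.mul_sum]
      rw [← Finset.sum_sub_distrib, ← Finset.sum_sub_distrib]
      refine Finset.sum_congr rfl fun t _ => ?_
      rw [(hlinω (i, k) t).1, (hlinω (i, k) t).2]
      simp only [hy, Pi.smul_apply, smul_eq_mul]
      ring
    simp only [hterm, Finset.sum_sub_distrib, ← Finset.mul_sum] at hmart
    change η * ∑ k, π k * ∑ t ∈ Finset.Icc 1 T, (μ[q k t | ℱ (t - 1)]) ω ≤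
      4 * η ^ 2 * ∑ k, π k * ∑ t ∈ Finset.Icc 1 T, (μ[fun ω' => q k t ω' ^ 2 | ℱ (t - 1)]) ω + _
    linarith

/-- The scale condition gives `G * (a / T) ^ (1 / (2 - β)) ≤ c`, with `c` the fast rate. If `a ≤ T`,
then `G a / T ≤ c`, and `1 ≤ 4 G a` absorbs the additive 1, giving `300 * (1 + 5) = 1800`. If `a ≥
T`, then `G ≤ c` and the trivial bound `2 G` suffices. -/
lemma fast_rate_of_slow_terms {G α β a risk : ℝ} {T : ℕ} (hα : 0 < α) (hβ1 : β ≤ 1)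
    (hT : 1 ≤ T) (ha : 1 / 4 ≤ a) (hG1 : 1 ≤ G) (hαG : α * G ^ (2 - β) ≤ 1)
    (hrisk : risk ≤ 300 * ((a / (α * T)) ^ (1 / (2 - β)) + (G * a + 1) / T))
    (htriv : risk ≤ 2 * G) :
    risk ≤ 1800 * (a / (α * T)) ^ (1 / (2 - β)) := by
  have hT' : (0 : ℝ) < T := by exact_mod_cast hT
  have hG : 0 < G := by linarith
  have hb : 0 < 2 - β := by linarith
  have ha0 : 0 < a := by linarith
  have haT : 0 < a / T := by positivity
  have hscale : G * (a / T) ^ (1 / (2 - β)) ≤ (a / (α * T)) ^ (1 / (2 - β)) := by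
    have h1 : G = (G ^ (2 - β)) ^ (1 / (2 - β)) := by
      rw [← Real.rpow_mul hG.le, one_div, mul_inv_cancel₀ hb.ne', Real.rpow_one]
    conv_lhs => rw [h1]
    rw [← Real.mul_rpow (by positivity) haT.le]
    refine Real.rpow_le_rpow (by positivity) ?_ (by positivity)
    rw [← div_div, div_right_comm, le_div_iff₀ hα]
    nlinarith
  set c := (a / (α * T)) ^ (1 / (2 - β))
  rcases le_total (a / T) 1 with h | h
  · have h1 : a / T ≤ (a / T) ^ (1 / (2 - β)) := by
      conv_lhs => rw [← Real.rpow_one (a / T)]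
      exact Real.rpow_le_rpow_of_exponent_ge haT h (by rw [div_le_one hb]; linarith)
    have h2 : (G * a + 1) / T ≤ 5 * (G * (a / T)) := by
      have h3 : 5 * (G * (a / T)) = (G * a + 4 * (G * a)) / T := by ring
      rw [h3]
      refine div_le_div_of_nonneg_right ?_ hT'.le
      nlinarith
    have h4 : G * (a / T) ≤ c := (mul_le_mul_of_nonneg_left h1 hG.le).trans hscale
    linarith
  · have h1 : 1 ≤ (a / T) ^ (1 / (2 - β)) := Real.one_le_rpow h (by positivity)
    have h2 : G ≤ c := by nlinarith
    linarith

end OnlineBOA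

theorem theorem1 :
    ∃ C : ℝ, 0 < C ∧
      ∀ (Ω : Type*) (mΩ : MeasurableSpace Ω) (μ : Measure Ω) (_ : IsProbabilityMeasure μ)
        (ℱ : Filtration ℕ mΩ) (d K T : ℕ)
        (ℓ : ℕ → Ω → (Fin d → ℝ) → ℝ) (grad : ℕ → Ω → (Fin d → ℝ) → (Fin d → ℝ))
        (θ : Fin K → Fin d → ℝ) (prior : Fin K → ℝ) (G α β x : ℝ),
        (∀ k, θ k ∈ OnlineBOA.l1Ball d) →
        prior ∈ stdSimplex ℝ (Fin K) →
        0 < G → 0 < α → 0 ≤ β → β ≤ 1 → 0 < x → 1 ≤ T →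
        -- the grid of learning rates is not empty
        1 ≤ Real.log (4 * G / 3 * T) →
        OnlineBOA.IsLossSequence μ ℱ ℓ grad →
        OnlineBOA.LipschitzLoss μ grad G →
        OnlineBOA.WeakExpConcave μ ℱ ℓ grad α β →
        ∃ S : Set Ω, MeasurableSet S ∧ ENNReal.ofReal (1 - 2 * Real.exp (-x)) ≤ μ S ∧
          ∀ ω ∈ S, ∀ π ∈ stdSimplex ℝ (Fin K),
            -- otherwise the Kullback-Leibler divergence is infinite
            (∀ k, prior k = 0 → π k = 0) →
            let a : ℝ := OnlineBOA.klFin π prior + Real.log (Real.log (G * T)) + x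
            let risk : ℝ := ∑ k, π k * OnlineBOA.avgRisk μ ℱ ℓ
              (fun t ω' => OnlineBOA.boaIterate (4 * G / 3) T prior θ (fun s => grad s ω') t)
              T (θ k) ω
            risk ≤ C * ((a / (α * T)) ^ (1 / (2 - β)) + (G * a + 1) / T) ∧
            (1 ≤ G → α * G ^ (2 - β) ≤ 1 → risk ≤ C * (a / (α * T)) ^ (1 / (2 - β))) := by
  refine ⟨1800, by norm_num, ?_⟩
  intro Ω mΩ μ _ ℱ d K T ℓ grad θ prior G α β x hθ hprior hG hα hβ hβ1 hx hT hgrid hloss hlip hwec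
  have hT' : (0 : ℝ) < T := by exact_mod_cast hT
  have hE : 0 < 4 * G / 3 := by positivity
  -- Below `log 2` the required probability is negative and the empty event works. Above it, `x`
  -- compensates for a possibly negative iterated logarithm.
  rcases lt_or_ge x (Real.log 2) with hx2 | hx2
  · refine ⟨∅, MeasurableSet.empty, ?_, fun ω hω => absurd hω (Set.notMem_empty ω)⟩
    have h1 : 1 / 2 ≤ Real.exp (-x) := by
      rw [Real.exp_neg, one_div]
      refine inv_anti₀ (Real.exp_pos _) ?_
      rw [← Real.le_log_iff_exp_le (by norm_num)]
      exact hx2.le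
    rw [ENNReal.ofReal_of_nonpos (by linarith)]
    exact zero_le
  set p : ℕ → Ω → Fin d → ℝ := fun t ω =>
    OnlineBOA.boaIterate (4 * G / 3) T prior θ (fun s => grad s ω) t with hp
  have hround := fun (k : Fin K) (t : ℕ) (h1 : 1 ≤ t) =>
    OnlineBOA.condExp_round_bounds (μ := μ) (m := ℱ (t - 1)) (f := ℓ t) (g := grad t)
      (u := θ k) (X := p (t - 1)) (ℱ.le _)
      (hloss.convex t h1) (hloss.subgradient t h1)
      (fun v => (hloss.measurable_loss t h1 v).mono (ℱ.le t) le_rfl)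
      ((hloss.measurable_grad t h1).mono
        (sup_le_sup (MeasurableSpace.comap_mono (ℱ.le t)) le_rfl) le_rfl)
      (hloss.integrable_loss t h1) (hlip t h1) hα hβ hβ1 (hθ k)
      (fun v hv => hwec t h1 v hv (θ k) (hθ k))
      (OnlineBOA.measurable_boaIterate hloss.measurable_grad (t - 1))
      (fun ω => OnlineBOA.boaPredict_mem_l1Ball hE hgrid hprior hθ _)
  have hrounds := ae_all_iff.mpr fun k => (Filter.eventually_all_finset (Finset.Icc 1 T)).mpr
    fun t ht => hround k t (Finset.mem_Icc.mp ht).1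
  obtain ⟨S, hSm, hSμ, hS⟩ := OnlineBOA.exists_event hθ hprior hG hgrid hloss hlip hrounds x hp
  refine ⟨S, hSm, le_trans (ENNReal.ofReal_le_ofReal ?_) hSμ, ?_⟩
  · linarith [Real.exp_pos (-x)]
  intro ω hω π hπ hac a risk
  obtain ⟨hbounds, hreg⟩ := hS ω hω
  have hKL := OnlineBOA.klFin_nonneg hπ hprior hac
  obtain ⟨ha, hB⟩ := OnlineBOA.complexity_bounds hG hT hgrid hx2 hKL
  change 1 / 4 ≤ a at ha
  change _ ≤ 6 * a at hB
  set Q := ∑ k, π k * ∑ t ∈ Finset.Icc 1 T,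
    (μ[fun ω' => grad t ω' (p (t - 1) ω') ⬝ᵥ (p (t - 1) ω' - θ k) | ℱ (t - 1)]) ω with hQ
  set V := ∑ k, π k * ∑ t ∈ Finset.Icc 1 T,
    (μ[fun ω' => (grad t ω' (p (t - 1) ω') ⬝ᵥ (p (t - 1) ω' - θ k)) ^ 2 | ℱ (t - 1)]) ω with hV
  set R := ∑ k, π k * ∑ t ∈ Finset.Icc 1 T, ((μ[fun ω' => ℓ t ω' (p (t - 1) ω') | ℱ (t - 1)]) ω -
    (μ[fun ω' => ℓ t ω' (θ k) | ℱ (t - 1)]) ω) with hR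
  have hriskR : risk = R / T := by
    simp only [risk, OnlineBOA.avgRisk, hR]
    rw [Finset.sum_div]
    refine Finset.sum_congr rfl fun k _ => ?_
    rw [Finset.sum_sub_distrib]
    ring
  have hmix : ∀ F H : Fin K → ℕ → ℝ, (∀ k, ∀ t ∈ Finset.Icc 1 T, F k t ≤ H k t) →
      ∑ k, π k * ∑ t ∈ Finset.Icc 1 T, F k t ≤ ∑ k, π k * ∑ t ∈ Finset.Icc 1 T, H k t :=
    fun F H h => Finset.sum_le_sum fun k _ =>
      mul_le_mul_of_nonneg_left (Finset.sum_le_sum (h k)) (hπ.1 k)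
  have hconst : ∀ b : ℝ, ∑ k, π k * ∑ t ∈ Finset.Icc 1 T, b = T * b := by
    intro b
    rw [← Finset.sum_mul, hπ.2]
    simp
  have hRQ : R ≤ Q := hmix _ _ fun k t ht => (hbounds k t ht).2.1
  have hQG : Q ≤ T * (2 * G) := by
    rw [← hconst]
    exact hmix _ _ fun k t ht => (hbounds k t ht).2.2.1
  have hVG : V ≤ 4 * G ^ 2 * T := by
    rw [mul_comm, ← hconst]
    exact hmix _ _ fun k t ht => (hbounds k t ht).2.2.2
  have hVS : ∀ c : ℚ, 0 < c →
      V ≤ ((c : ℝ) ^ (β - 1) / α + 4 * G) * (Q - R) + T * ((c : ℝ) ^ β / α) := by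
    intro c hc
    refine (hmix _ _ fun k t ht => (hbounds k t ht).1 c hc).trans (le_of_eq ?_)
    rw [← hconst, hQ, hR, ← Finset.sum_sub_distrib, Finset.mul_sum, ← Finset.sum_add_distrib]
    refine Finset.sum_congr rfl fun k _ => ?_
    rw [Finset.sum_add_distrib, ← Finset.mul_sum, Finset.sum_sub_distrib]
    ring
  have hB0 : 0 ≤ 2 * (OnlineBOA.klFin π prior +
      Real.log (OnlineBOA.rateIndices (4 * G / 3) T).card) + x := by
    have := Real.log_natCast_nonneg (OnlineBOA.rateIndices (4 * G / 3) T).card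
    linarith
  -- The gap is taken to be `Q - R`, so the bounded difference `Q - (Q - R)` is the regret `R`
  -- itself.
  have htune := OnlineBOA.sub_le_of_tuning hG hα hβ hβ1 hT hgrid (by linarith : 0 < a) hB0 hB
    (sub_nonneg.mpr hRQ) hVG (fun i hi => hreg i hi π hπ hac) hVS
  rw [sub_sub_cancel] at htune
  have hmain : risk ≤ 300 * ((a / (α * T)) ^ (1 / (2 - β)) + (G * a + 1) / T) := by
    rw [hriskR, div_le_iff₀ hT']
    refine htune.trans (le_of_eq ?_)
    field_simp
    ring
  refine ⟨hmain.trans ?_, fun hG1 hαG => ?_⟩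
  · have h1 : 0 ≤ (a / (α * T)) ^ (1 / (2 - β)) :=
      Real.rpow_nonneg (div_nonneg (by linarith) (by positivity)) _
    have h2 : 0 ≤ (G * a + 1) / T :=
      div_nonneg (add_nonneg (mul_nonneg hG.le (by linarith)) zero_le_one) hT'.le
    linarith
  · refine OnlineBOA.fast_rate_of_slow_terms hα hβ1 hT ha hG1 hαG hmain ?_
    rw [hriskR, div_le_iff₀ hT']
    linarith
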